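/- Let $p>q>0$ and $p>q'>0$ be integers with $q$ and $q'$ coprime to $p$. For $k\in\mathbb Z/p$ let $\rho_q^k(z,w)=(\zeta^k z,\zeta^{qk}w)$, $\zeta=e^{2\pi i/p}$, act on $S^3\subset\mathbb C^2$, let $L(p,q)=S^3/(\mathbb Z/p)$, and let $X_0=\{(x,y)\in L(p,q)^2 : x\ne y\}$ be its deleted square, with $\pi_1(X_0)=\pi_1(L(p,q)\times L(p,q))=\mathbb Z/p\oplus\mathbb Z/p$ (the canonical generator of $\pi_1(L(p,q))=\mathbb Z/p$ being the class of the image of a path in $S^3$ from a point to its image under $\rho_q$). Let $\tilde X_0=\{(u,v)\in S^3\times S^3 : u\neq\rho_q^k v \text{ for all } k\in\mathbb Z/p\}$ be its universal cover, with the deck transformations $\tau_{m,n}(u,v)=(\rho_q^m u,\rho_q^n v)$, $(m,n)\in\mathbb Z/p\oplus\mathbb Z/p$. Let $X_0'$, $\tilde X_0'$, $\tau'_{m,n}$ be the same objects for $L(p,q')$. Let $f:X_0'\to X_0$ be a homotopy equivalence such that $f_*:\pi_1(X_0')\to\pi_1(X_0)$ is given, in the canonical bases, by a matrix $\operatorname{diag}(\alpha,\pm\alpha)$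 with $\alpha\in\mathbb Z/p$. Then: (1) The matrix is $\operatorname{diag}(\alpha,\alpha)$; that is, the sign is $+$ if $p>2$ (for $p=2$ the two signs give the same matrix). (2) The map $f$ lifts to a continuous map $\tilde f:\tilde X_0'\to\tilde X_0$ of the universal covers. For every such lift, $\tilde f^*:H^2(\tilde X_0;\mathbb Z)\to H^2(\tilde X_0';\mathbb Z)$ is an isomorphism, and for all $m,n\in\mathbb Z/p$ one has $\tilde f\circ\tau'_{m,n}=\tau_{\alpha m,\alpha n}\circ\tilde f$ and hence $\tilde f^*\circ\tau_{\alpha m,\alpha n}^*=(\tau'_{m,n})^*\circ\tilde f^*$ on $H^2$. (3) Let $N=1+t+\dots+t^{p-1}$. The groups $H^2(\tilde X_0;\mathbb Z)$ and $H^2(\tilde X_0';\mathbb Z)$ are modules over $\mathbb Z[t]/(N)$ with $t$ acting by $\tau_{1,0}^*$ and $(\tau'_{1,0})^*$ respectively, and for every lift $\tilde f$ of $f$ one has $\tilde f^*(t^{\alpha}x)=t\,\tilde f^*(x)$ for all $x\in H^2(\tilde X_0;\mathbb Z)$. -/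

import Mathlib

open CategoryTheory
open scoped unitInterval

noncomputable section

/-! ### Singular cohomology with integer coefficients -/

namespace SingularCohomology

/-- The singular chain complex of a topological space, with integer coefficients. -/
abbrev chains (X : Type) [TopologicalSpace X] : ChainComplex (ModuleCat.{0} ℤ) ℕ :=
  ((AlgebraicTopology.singularChainComplexFunctor (ModuleCat.{0} ℤ)).obj
    (ModuleCat.of ℤ ℤ)).obj (TopCat.of X)

/-- The chain map induced by a continuous map. -/
abbrev chainsMap {X Y : Type} [TopologicalSpace X] [TopologicalSpace Y] (f : C(X, Y)) :
    chains X ⟶ chains Y :=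
  ((AlgebraicTopology.singularChainComplexFunctor (ModuleCat.{0} ℤ)).obj
    (ModuleCat.of ℤ ℤ)).map (TopCat.ofHom f)

/-- Singular cochains: the group of homomorphisms from the singular `n`-chains to `ℤ`. -/
abbrev Cochain (X : Type) [TopologicalSpace X] (n : ℕ) : Type :=
  (chains X).X n ⟶ ModuleCat.of ℤ ℤ

/-- The coboundary from `m`-cochains to `n`-cochains, that is, precomposition with the boundary
from `n`-chains to `m`-chains. It is the zero map unless `n = m + 1`. -/
def coboundary (X : Type) [TopologicalSpace X] (m n : ℕ) : Cochain X m →+ Cochain X n where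
  toFun φ := (chains X).d n m ≫ φ
  map_zero' := Limits.comp_zero
  map_add' φ ψ := Preadditive.comp_add _ _ _ _ φ ψ

/-- Singular `n`-cocycles. -/
def cocycles (X : Type) [TopologicalSpace X] (n : ℕ) : AddSubgroup (Cochain X n) :=
  (coboundary X n (n + 1)).ker

/-- Singular `n`-coboundaries. In degree `0` they vanish, since then `coboundary X 0 0 = 0`. -/
def coboundaries (X : Type) [TopologicalSpace X] (n : ℕ) : AddSubgroup (Cochain X n) :=
  (coboundary X (n - 1) n).range

end SingularCohomology

open SingularCohomology in
/-- The singular cohomology group `H^n(X; ℤ)`. -/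
abbrev SingularCohomology (X : Type) [TopologicalSpace X] (n : ℕ) : Type :=
  cocycles X n ⧸ (coboundaries X n).addSubgroupOf (cocycles X n)

namespace SingularCohomology

variable {X Y : Type} [TopologicalSpace X] [TopologicalSpace Y]

/-- Pull-back of cochains. -/
def cochainPullback (f : C(X, Y)) (n : ℕ) : Cochain Y n →+ Cochain X n where
  toFun φ := (chainsMap f).f n ≫ φ
  map_zero' := Limits.comp_zero
  map_add' φ ψ := Preadditive.comp_add _ _ _ _ φ ψ

theorem cochainPullback_coboundary (f : C(X, Y)) (m n : ℕ) (φ : Cochain Y m) :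
    cochainPullback f n (coboundary Y m n φ) = coboundary X m n (cochainPullback f m φ) := by
  change (chainsMap f).f n ≫ (chains Y).d n m ≫ φ
    = (chains X).d n m ≫ (chainsMap f).f m ≫ φ
  rw [← Category.assoc, ← Category.assoc, (chainsMap f).comm n m]

/-- Pull-back of cocycles. -/
def cocyclePullback (f : C(X, Y)) (n : ℕ) : cocycles Y n →+ cocycles X n :=
  ((cochainPullback f n).comp (cocycles Y n).subtype).codRestrict (cocycles X n) (by
    rintro ⟨φ, hφ⟩
    have h : coboundary Y n (n + 1) φ = 0 := hφ
    change coboundary X n (n + 1) (cochainPullback f n φ) = 0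
    rw [← cochainPullback_coboundary, h, map_zero])

/-- The homomorphism `f^* : H^n(Y; ℤ) → H^n(X; ℤ)` induced by a continuous map `f : X → Y`. -/
def pullback (f : C(X, Y)) (n : ℕ) : SingularCohomology Y n →+ SingularCohomology X n :=
  QuotientAddGroup.map _ _ (cocyclePullback f n) (by
    rintro ⟨φ, hφ⟩ h
    obtain ⟨ψ, hψ⟩ : ∃ ψ, coboundary Y (n - 1) n ψ = φ := h
    refine ⟨cochainPullback f (n - 1) ψ, ?_⟩
    change coboundary X (n - 1) n (cochainPullback f (n - 1) ψ) = cochainPullback f n φ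
    rw [← cochainPullback_coboundary, hψ])

end SingularCohomology

/-! ### Lens spaces -/

/-- The unit sphere `S³ ⊆ ℂ²`. -/
abbrev Sphere3 : Type := {z : ℂ × ℂ // ‖z.1‖ ^ 2 + ‖z.2‖ ^ 2 = 1}

/-- The `k`-th power `(z, w) ↦ (ζ^k z, ζ^{qk} w)`, `ζ = e^{2πi/p}`, of the standard rotation. -/
def rot (p q : ℕ) [NeZero p] (k : ZMod p) (z : Sphere3) : Sphere3 :=
  ⟨((ZMod.toCircle k : ℂ) * z.1.1, (ZMod.toCircle ((q : ZMod p) * k) : ℂ) * z.1.2), by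
    rw [norm_mul, norm_mul, Circle.norm_coe, Circle.norm_coe, one_mul, one_mul]
    exact z.2⟩

section

variable (p q : ℕ) [NeZero p]

theorem continuous_rot (k : ZMod p) : Continuous (rot p q k) := by
  unfold rot
  fun_prop

theorem rot_zero (z : Sphere3) : rot p q 0 z = z := by
  apply Subtype.ext
  simp [rot]

theorem rot_rot (j k : ZMod p) (z : Sphere3) : rot p q j (rot p q k z) = rot p q (j + k) z := by
  apply Subtype.ext
  simp [rot, mul_add, AddChar.map_add_eq_mul, mul_assoc]

/-- Two points of `S³` are equivalent if they lie in one orbit of the rotation group `ℤ/p`. -/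
def lensSetoid : Setoid Sphere3 where
  r z w := ∃ k : ZMod p, z = rot p q k w
  iseqv := by
    refine ⟨fun z => ⟨0, (rot_zero p q z).symm⟩, ?_, ?_⟩
    · rintro z w ⟨k, rfl⟩
      exact ⟨-k, by rw [rot_rot, neg_add_cancel, rot_zero]⟩
    · rintro z w u ⟨k, rfl⟩ ⟨l, rfl⟩
      exact ⟨k + l, by rw [rot_rot]⟩

/-- The lens space `L(p, q) = S³ / (ℤ/p)`, with the quotient topology. -/
abbrev LensSpace : Type := Quotient (lensSetoid p q)

/-- The quotient map `S³ → L(p, q)`. -/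
def lensMk (z : Sphere3) : LensSpace p q := Quotient.mk (lensSetoid p q) z

/-- `g` is `m` times the canonical generator of `π₁(L(p, q)) = ℤ/p`: it is represented by a loop
that has a lift to `S³` leading from some point to its image under the `m`-th power of the
rotation. -/
def IsLensClass {x : LensSpace p q} (g : FundamentalGroup (LensSpace p q) x) (m : ZMod p) : Prop :=
  ∃ (γ : Path x x) (l : C(I, Sphere3)),
    FundamentalGroup.fromPath (Path.Homotopic.Quotient.mk γ) = g ∧
    (∀ t, lensMk p q (l t) = γ t) ∧ l 1 = rot p q m (l 0)

/-! ### Deleted squares and their universal covers -/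

/-- The deleted square `X₀ = L × L ∖ Δ` of the lens space `L = L(p, q)`. -/
abbrev DeletedSquare : Type := {x : LensSpace p q × LensSpace p q // x.1 ≠ x.2}

/-- The first projection `X₀ → L`. -/
def DeletedSquare.fst : C(DeletedSquare p q, LensSpace p q) := ⟨fun x => x.1.1, by fun_prop⟩

/-- The second projection `X₀ → L`. -/
def DeletedSquare.snd : C(DeletedSquare p q, LensSpace p q) := ⟨fun x => x.1.2, by fun_prop⟩

/-- The class `g ∈ π₁(X₀)` equals `(m, n)` under the canonical identification
`π₁(X₀) = π₁(L × L) = ℤ/p ⊕ ℤ/p`. -/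
def IsDeletedSquareClass {x : DeletedSquare p q} (g : FundamentalGroup (DeletedSquare p q) x)
    (m n : ZMod p) : Prop :=
  IsLensClass p q (FundamentalGroup.map (DeletedSquare.fst p q) x g) m ∧
  IsLensClass p q (FundamentalGroup.map (DeletedSquare.snd p q) x g) n

/-- The universal cover of `X₀`: pairs of points of `S³` that do not lie in one orbit. -/
abbrev OrbitConf : Type := {x : Sphere3 × Sphere3 // ∀ k : ZMod p, x.1 ≠ rot p q k x.2}

/-- The universal covering projection, from the orbit configuration space to `X₀`. -/
def orbitConfProj : C(OrbitConf p q, DeletedSquare p q) where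
  toFun x := ⟨(lensMk p q x.1.1, lensMk p q x.1.2), fun h => by
    obtain ⟨k, hk⟩ : ∃ k : ZMod p, x.1.1 = rot p q k x.1.2 := Quotient.exact h
    exact x.2 k hk⟩
  continuous_toFun := by
    have h : Continuous (lensMk p q) := continuous_quotient_mk'
    fun_prop

/-- The deck transformation `τ_{m,n}` of the universal cover of `X₀`. -/
def deck (m n : ZMod p) : C(OrbitConf p q, OrbitConf p q) where
  toFun x := ⟨(rot p q m x.1.1, rot p q n x.1.2), fun k hk => x.2 (-m + (k + n)) (by
    have h : rot p q m x.1.1 = rot p q k (rot p q n x.1.2) := hk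
    rw [← rot_rot, ← rot_rot, ← h, rot_rot, neg_add_cancel, rot_zero])⟩
  continuous_toFun := by
    have hm := continuous_rot p q m
    have hn := continuous_rot p q n
    fun_prop

/-- The second integral cohomology of the universal cover of `X₀`. -/
abbrev H2 : Type := SingularCohomology (OrbitConf p q) 2

/-- The automorphism `τ_{m,n}^*` of the second cohomology. -/
def deckH2 (m n : ZMod p) : H2 p q →+ H2 p q := SingularCohomology.pullback (deck p q m n) 2

/-! ### Maps between deleted squares -/

variable {p q}
variable {q' : ℕ}

/-- With respect to the canonical bases, `f_* : π₁(X'₀, x₀) → π₁(X₀, f x₀)` is multiplication of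
column vectors in `ℤ/p ⊕ ℤ/p` by the matrix `A`. -/
def HasPi1Matrix (f : C(DeletedSquare p q', DeletedSquare p q)) (x₀ : DeletedSquare p q')
    (A : Matrix (Fin 2) (Fin 2) (ZMod p)) : Prop :=
  ∀ (g : FundamentalGroup (DeletedSquare p q') x₀) (m n : ZMod p),
    IsDeletedSquareClass p q' g m n →
    IsDeletedSquareClass p q (FundamentalGroup.map f x₀ g)
      (A 0 0 * m + A 0 1 * n) (A 1 0 * m + A 1 1 * n)

/-- `F` is a lift of `f` to the universal covers. -/
def IsLiftOf (F : C(OrbitConf p q', OrbitConf p q))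
    (f : C(DeletedSquare p q', DeletedSquare p q)) : Prop :=
  ∀ x, orbitConfProj p q (F x) = f (orbitConfProj p q' x)

end

/-- The ring `ℤ[t]/(N)`, `N = 1 + t + ⋯ + t^{p-1}`. -/
abbrev CycRing (p : ℕ) : Type :=
  AdjoinRoot (∑ i ∈ Finset.range p, (Polynomial.X : Polynomial ℤ) ^ i)

/-- The class of `t` in `ℤ[t]/(N)`. -/
def CycRing.t (p : ℕ) : CycRing p :=
  AdjoinRoot.root (∑ i ∈ Finset.range p, (Polynomial.X : Polynomial ℤ) ^ i)

end

/-!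
The universal cover `X̃` of the deleted square is the complement in `S³ × S³` of the `p` disjoint
graphs of the rotations `ρ^j`. The proof rests on three facts about `H²(X̃)`.

* `deckH2_diagonal`: `τ_{m,m}^* = 1`, because `ρ^m` is isotopic to the identity through rotations of
  `S³` that commute with `ρ`.
* `sum_deckH2`: `∑ k, τ_{k,0}^* = 0`. The connecting homomorphism embeds `H²(X̃)` in the sum of the
  groups `H³(S³ × S³, complement of the j-th graph)`, as the kernel of the map to `H³(S³ × S³)`,
  which is injective on each summand. The rotations of the first factor permute the graphs and act
  trivially on `H³(S³ × S³)`. So every component of the sum of the translates of a class is mapped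
  to the sum of the images of all components of the class, which is zero.
* `exists_deckH2_ne`: `τ_{k,0}^* ≠ 1` if `p > 2` and `k ≠ 0`. The differences of the Thom classes of
  two graphs lie in that kernel, and a rotation permutes the Thom classes without fixed points.

These are proved with cochains that are functions on singular simplices; `VanishesOn A c` says that
`c` is a relative cochain of the pair with subspace `A`. Mathlib supplies homotopy invariance.
Excision is the small simplices theorem `VanishesOnSmall.exists_delta_eq`, proved by barycentric
subdivision. The cohomology of `S³` and of `S³ × S³` in low degrees follows by Mayer–Vietoris
arguments, and the complement of a single graph is homotopy equivalent to `S³`.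

The maps are handled by covering space theory. Since `S³ → L(p, q)` and `X̃ → X₀` are quotients by
free actions of finite groups, the class of a loop is read off from any of its lifts. So a map `f`
with matrix `diag(α, β)` lifts to the universal covers (`HasPi1Matrix.exists_isLiftOf`), and its
lifts `F` satisfy `F ∘ τ'_{m,n} = τ_{αm,βn} ∘ F` (`IsLiftOf.comp_deck`). If `f` is a homotopy
equivalence, then a homotopy inverse lifts as well, `F^*` is an isomorphism and `α` and `β` are
units.

For the sign, suppose that `β = -α` and `p > 2`. Then `τ_{α,-α}^*` corresponds under `F^*` to
`(τ'_{1,1})^* = 1`, so it is trivial. Since `τ_{α,α}^*` is trivial, so is `τ_{2α,0}^*`, although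
`2α ≠ 0`. The module structure is the vanishing of `∑ k, τ_{k,0}^*`.
-/

noncomputable section

namespace SingularCohomology

/-! ### Singular cochains as functions on singular simplices -/

/-- The singular `n`-simplices of a space. -/
abbrev Simp (X : Type) [TopologicalSpace X] (n : ℕ) : Type := C(stdSimplex ℝ (Fin (n + 1)), X)

/-- The inclusion of the face of the standard simplex opposite to the `i`-th vertex. -/
def face (n : ℕ) (i : Fin (n + 2)) :
    C(stdSimplex ℝ (Fin (n + 1)), stdSimplex ℝ (Fin (n + 2))) :=
  ⟨stdSimplex.map i.succAbove, stdSimplex.continuous_map _⟩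

section Pairing

variable {A : ModuleCat.{0} ℤ}

theorem hom_comp_zero_apply_one (i : ModuleCat.of ℤ ℤ ⟶ A) :
    (i ≫ (0 : A ⟶ ModuleCat.of ℤ ℤ)).hom (1 : ℤ) = (0 : ℤ) := by
  simp

theorem hom_comp_add_apply_one (i : ModuleCat.of ℤ ℤ ⟶ A) (φ ψ : A ⟶ ModuleCat.of ℤ ℤ) :
    (i ≫ (φ + ψ)).hom (1 : ℤ) = ((i ≫ φ).hom (1 : ℤ) + (i ≫ ψ).hom (1 : ℤ) : ℤ) := by
  simp

theorem hom_alternating_sum_comp_apply_one {m : ℕ} (i : Fin m → (ModuleCat.of ℤ ℤ ⟶ A))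
    (φ : A ⟶ ModuleCat.of ℤ ℤ) :
    ((∑ j, (-1 : ℤ) ^ j.val • i j) ≫ φ).hom (1 : ℤ)
      = (∑ j, (-1) ^ j.val * (i j ≫ φ).hom (1 : ℤ) : ℤ) := by
  have h : ∀ (a : ℤ) (f : A), φ.hom (a • f) = a * φ.hom f := fun a f =>
    (map_zsmul φ.hom a f).trans (zsmul_eq_mul _ _)
  simp only [ModuleCat.hom_comp, ModuleCat.hom_sum, ModuleCat.hom_smul, LinearMap.comp_apply,
    LinearMap.sum_apply, LinearMap.smul_apply, map_sum, h]

end Pairing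

section

variable {X Y : Type} [TopologicalSpace X] [TopologicalSpace Y] {n : ℕ}

/-- The coboundary of a singular cochain, seen as a function on singular simplices. -/
def delta (φ : Simp X n → ℤ) (s : Simp X (n + 1)) : ℤ :=
  ∑ i : Fin (n + 2), (-1) ^ i.val * φ (s.comp (face n i))

/-- The singular simplex of `TopCat.toSSet` given by a continuous map. -/
def simplexOf (s : Simp X n) : (TopCat.toSSet.obj (TopCat.of X)).obj (.op (.mk n)) :=
  (TopCat.toSSetObjEquiv (TopCat.of X) (.op (.mk n))).symm s

/-- The values of a singular cochain on the singular simplices. The summand of the `n`-chains that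
belongs to a simplex `s` is a copy of `ℤ`, and the value on `s` is the value on its generator. -/
def evalSimp (φ : Cochain X n) (s : Simp X n) : ℤ :=
  (SSet.ιChainComplex (TopCat.toSSet.obj (TopCat.of X)) (R := ModuleCat.of ℤ ℤ)
    (simplexOf s) ≫ φ).hom (1 : ℤ)

theorem simplexOf_surjective (x : (TopCat.toSSet.obj (TopCat.of X)).obj (.op (.mk n))) :
    ∃ s : Simp X n, simplexOf s = x :=
  ⟨TopCat.toSSetObjEquiv (TopCat.of X) (.op (.mk n)) x, Equiv.symm_apply_apply _ _⟩

theorem map_simplexOf (f : C(X, Y)) (s : Simp X n) :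
    (TopCat.toSSet.map (TopCat.ofHom f)).app _ (simplexOf s) = simplexOf (f.comp s) := by
  rfl

theorem evalSimp_injective : Function.Injective (evalSimp : Cochain X n → Simp X n → ℤ) := by
  intro φ ψ h
  refine SSet.chainComplex_hom_ext fun x => ?_
  obtain ⟨s, rfl⟩ := simplexOf_surjective x
  ext
  exact congrFun h s

theorem evalSimp_surjective : Function.Surjective (evalSimp : Cochain X n → Simp X n → ℤ) := by
  intro c
  refine ⟨(SSet.isColimitChainComplexXCofan _ (ModuleCat.of ℤ ℤ) n).desc
    (Limits.Cofan.mk _ fun x => ModuleCat.ofHom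
      (LinearMap.lsmul ℤ ℤ (c (TopCat.toSSetObjEquiv (TopCat.of X) (.op (.mk n)) x)))), ?_⟩
  ext s
  have := (SSet.isColimitChainComplexXCofan (TopCat.toSSet.obj (TopCat.of X))
    (ModuleCat.of ℤ ℤ) n).fac
    (Limits.Cofan.mk _ fun x => ModuleCat.ofHom
      (LinearMap.lsmul ℤ ℤ (c (TopCat.toSSetObjEquiv (TopCat.of X) (.op (.mk n)) x))))
      ⟨simplexOf s⟩
  have h2 := congrArg (fun g => (g.hom (1 : ℤ) : ℤ)) this
  refine Eq.trans h2 ?_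
  simp [simplexOf]

theorem evalSimp_zero : evalSimp (0 : Cochain X n) = 0 :=
  funext fun _ => hom_comp_zero_apply_one _

theorem evalSimp_add (φ ψ : Cochain X n) : evalSimp (φ + ψ) = evalSimp φ + evalSimp ψ :=
  funext fun _ => hom_comp_add_apply_one _ φ ψ

theorem evalSimp_sub (φ ψ : Cochain X n) : evalSimp (φ - ψ) = evalSimp φ - evalSimp ψ := by
  rw [eq_sub_iff_add_eq, ← evalSimp_add, sub_add_cancel]

theorem evalSimp_coboundary (φ : Cochain X n) :
    evalSimp (coboundary X n (n + 1) φ) = delta (evalSimp φ) := by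
  funext s
  have h := SSet.ιChainComplex_d_assoc (R := ModuleCat.of ℤ ℤ) _ (simplexOf s) φ
  exact (congrArg (fun g => (g.hom (1 : ℤ) : ℤ)) h).trans (hom_alternating_sum_comp_apply_one _ φ)

theorem evalSimp_cochainPullback (f : C(X, Y)) (φ : Cochain Y n) :
    evalSimp (cochainPullback f n φ) = fun s => evalSimp φ (f.comp s) := by
  funext s
  have h := SSet.ι_chainComplexMap_f_assoc (R := ModuleCat.of ℤ ℤ) _ _
    (TopCat.toSSet.map (TopCat.ofHom f)) (simplexOf s) φ
  exact congrArg (fun g => (g.hom (1 : ℤ) : ℤ)) h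

theorem delta_add (c d : Simp X n → ℤ) : delta (c + d) = delta c + delta d := by
  funext s
  simp [delta, mul_add, Finset.sum_add_distrib]

theorem delta_sub (c d : Simp X n → ℤ) : delta (c - d) = delta c - delta d := by
  funext s
  simp [delta, mul_sub, Finset.sum_sub_distrib]

theorem delta_zero : delta (0 : Simp X n → ℤ) = 0 := by
  funext s
  simp [delta]

theorem delta_sum {ι : Type*} (t : Finset ι) (c : ι → Simp X n → ℤ) :
    delta (∑ i ∈ t, c i) = ∑ i ∈ t, delta (c i) :=
  map_sum (AddMonoidHom.mk' delta delta_add) c t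

theorem delta_delta (c : Simp X n → ℤ) : delta (delta c) = 0 := by
  obtain ⟨φ, rfl⟩ := evalSimp_surjective c
  rw [← evalSimp_coboundary, ← evalSimp_coboundary, ← evalSimp_zero]
  congr 1
  change (chains X).d (n + 1 + 1) (n + 1) ≫ (chains X).d (n + 1) n ≫ φ = 0
  rw [← Category.assoc, HomologicalComplex.d_comp_d, Limits.zero_comp]

/-- Homotopic maps pull a cocycle back to cohomologous cocycles. -/
theorem exists_delta_eq_of_homotopic {f g : C(X, Y)} (h : f.Homotopic g) (c : Simp Y (n + 1) → ℤ)
    (hc : delta c = 0) :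
    ∃ b : Simp X n → ℤ, delta b = fun s => c (f.comp s) - c (g.comp s) := by
  obtain ⟨H⟩ := h
  obtain ⟨φ, rfl⟩ := evalSimp_surjective c
  have hφ : (chains Y).d (n + 2) (n + 1) ≫ φ = 0 := by
    apply evalSimp_injective
    exact (evalSimp_coboundary φ).trans (hc.trans evalSimp_zero.symm)
  let h : Homotopy (chainsMap f) (chainsMap g) :=
    TopCat.Homotopy.singularChainComplexFunctorObjMap (f := TopCat.ofHom f) (g := TopCat.ofHom g)
      H (ModuleCat.of ℤ ℤ)
  refine ⟨evalSimp (h.hom n (n + 1) ≫ φ), ?_⟩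
  have key : cochainPullback f (n + 1) φ
      = coboundary X n (n + 1) (h.hom n (n + 1) ≫ φ) + cochainPullback g (n + 1) φ := by
    have := h.comm (n + 1)
    rw [dNext_eq h.hom (i := n + 1) (i' := n) (by simp),
      prevD_eq h.hom (j := n + 1) (j' := n + 2) (by simp)] at this
    change (chainsMap f).f (n + 1) ≫ φ = (chains X).d (n + 1) n ≫ h.hom n (n + 1) ≫ φ +
      (chainsMap g).f (n + 1) ≫ φ
    rw [this]
    simp [Preadditive.add_comp, hφ]
  have := congrArg evalSimp key
  rw [evalSimp_add, evalSimp_coboundary, evalSimp_cochainPullback, evalSimp_cochainPullback] at this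
  funext s
  have := congrFun this s
  simp only [Pi.add_apply] at this
  omega

end

/-! ### Ordered cochains on tuples and their barycentric subdivision -/

section Tuples

variable {K L : Type*} {n : ℕ}

/-- The coboundary of an ordered cochain, a function on tuples of points. For affine simplices of a
standard simplex, the tuples are the vertices. -/
def tupleDelta (φ : (Fin (n + 1) → K) → ℤ) (v : Fin (n + 2) → K) : ℤ :=
  ∑ i : Fin (n + 2), (-1) ^ i.val * φ (v ∘ i.succAbove)

/-- The dual of the cone construction with apex `b`. -/
def cone (b : K) (φ : (Fin (n + 2) → K) → ℤ) (w : Fin (n + 1) → K) : ℤ := φ (Fin.cons b w)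

theorem tupleDelta_sub (φ ψ : (Fin (n + 1) → K) → ℤ) :
    tupleDelta (φ - ψ) = tupleDelta φ - tupleDelta ψ := by
  funext v
  simp [tupleDelta, mul_sub, Finset.sum_sub_distrib]

theorem tupleDelta_zero : tupleDelta (0 : (Fin (n + 1) → K) → ℤ) = 0 := by
  funext v
  simp [tupleDelta]

theorem cons_comp_succAbove_succ (b : K) (w : Fin (n + 2) → K) (i : Fin (n + 2)) :
    (Fin.cons b w : Fin (n + 3) → K) ∘ i.succ.succAbove = Fin.cons b (w ∘ i.succAbove) := by
  funext j
  refine Fin.cases ?_ (fun j => ?_) j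
  · simp
  · simp

theorem cons_comp_succAbove_zero (b : K) (w : Fin (n + 1) → K) :
    (Fin.cons b w : Fin (n + 2) → K) ∘ (0 : Fin (n + 2)).succAbove = w := by
  funext j
  simp

/-- The cone is a contracting homotopy in positive degrees. -/
theorem cone_tupleDelta (b : K) (φ : (Fin (n + 2) → K) → ℤ) :
    cone b (tupleDelta φ) = φ - tupleDelta (cone b φ) := by
  funext w
  simp only [cone, tupleDelta, Pi.sub_apply]
  rw [Fin.sum_univ_succ, cons_comp_succAbove_zero]
  simp only [cons_comp_succAbove_succ, Fin.val_succ, pow_succ, Fin.val_zero, pow_zero, one_mul,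
    mul_neg_one, neg_mul, Finset.sum_neg_distrib, sub_eq_add_neg]

theorem tupleDelta_tupleDelta {n : ℕ} (φ : (Fin (n + 1) → K) → ℤ) :
    tupleDelta (tupleDelta φ) = 0 := by
  induction n with
  | zero =>
    funext v
    have h : ∀ a b : Fin 1 → K, a 0 = b 0 → φ a = φ b := fun a b h =>
      congrArg φ (funext fun i => by rw [Subsingleton.elim i 0, h])
    have h1 := h ((v ∘ Fin.succAbove 0) ∘ Fin.succAbove 0) ((v ∘ Fin.succAbove 1) ∘ Fin.succAbove 0)
      rfl
    have h2 := h ((v ∘ Fin.succAbove 0) ∘ Fin.succAbove 1) ((v ∘ Fin.succAbove 2) ∘ Fin.succAbove 0)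
      rfl
    have h3 := h ((v ∘ Fin.succAbove 1) ∘ Fin.succAbove 1) ((v ∘ Fin.succAbove 2) ∘ Fin.succAbove 1)
      rfl
    simp only [tupleDelta, Fin.sum_univ_succ, Finset.univ_unique, Finset.sum_singleton,
      Fin.default_eq_zero, Fin.succ_zero_eq_one, Fin.succ_one_eq_two, Pi.zero_apply] at *
    rw [h1, h2, h3]
    norm_num
    ring
  | succ n ih =>
    funext v
    obtain ⟨b, w, rfl⟩ : ∃ b w, v = Fin.cons b w := ⟨v 0, Fin.tail v, (Fin.cons_self_tail v).symm⟩
    change cone b (tupleDelta (tupleDelta φ)) w = 0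
    rw [cone_tupleDelta, cone_tupleDelta, tupleDelta_sub, ih]
    simp

variable (β : (n : ℕ) → (Fin (n + 1) → K) → K)

/-- The dual of the subdivision operator: the subdivision of a simplex is the cone from its
centre `β` over the subdivision of its boundary. -/
def subdiv : (n : ℕ) → ((Fin (n + 1) → K) → ℤ) → ((Fin (n + 1) → K) → ℤ)
  | 0, φ => φ
  | n + 1, φ => fun v => tupleDelta (subdiv n (cone (β (n + 1) v) φ)) v

/-- The dual of the natural chain homotopy between the identity and the subdivision operator. -/
def subdivHomotopy : (n : ℕ) → ((Fin (n + 2) → K) → ℤ) → ((Fin (n + 1) → K) → ℤ)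
  | 0, _ => 0
  | n + 1, φ => fun v => cone (β (n + 1) v) φ v
      - tupleDelta (subdivHomotopy n (cone (β (n + 1) v) φ)) v

theorem cone_sub (b : K) (φ ψ : (Fin (n + 2) → K) → ℤ) :
    cone b (φ - ψ) = cone b φ - cone b ψ := rfl

theorem subdiv_sub (n : ℕ) (φ ψ : (Fin (n + 1) → K) → ℤ) :
    subdiv β n (φ - ψ) = subdiv β n φ - subdiv β n ψ := by
  induction n with
  | zero => rfl
  | succ n ih =>
    funext v
    simp only [subdiv, cone_sub, ih, tupleDelta_sub, Pi.sub_apply]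

theorem subdivHomotopy_sub (n : ℕ) (φ ψ : (Fin (n + 2) → K) → ℤ) :
    subdivHomotopy β n (φ - ψ) = subdivHomotopy β n φ - subdivHomotopy β n ψ := by
  induction n with
  | zero => simp [subdivHomotopy]
  | succ n ih =>
    funext v
    simp only [subdivHomotopy, cone_sub, ih, tupleDelta_sub, Pi.sub_apply]
    ring

theorem subdivHomotopy_zero (n : ℕ) :
    subdivHomotopy β n (0 : (Fin (n + 2) → K) → ℤ) = 0 := by
  simpa using subdivHomotopy_sub β n 0 0

/-- Subdivision is a cochain map. -/
theorem subdiv_tupleDelta (n : ℕ) (φ : (Fin (n + 1) → K) → ℤ) :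
    subdiv β (n + 1) (tupleDelta φ) = tupleDelta (subdiv β n φ) := by
  induction n with
  | zero =>
    funext v
    have h : tupleDelta (cone (β 1 v) (tupleDelta φ)) = tupleDelta φ := by
      have : cone (β 1 v) (tupleDelta φ) = φ - fun _ => φ ![β 1 v] := by
        funext w
        change ∑ i : Fin 2, (-1) ^ i.val * φ ((Fin.cons (β 1 v) w : Fin 2 → K) ∘ i.succAbove) = _
        rw [Fin.sum_univ_two]
        have h1 : (Fin.cons (β 1 v) w : Fin 2 → K) ∘ Fin.succAbove 0 = w := by
          funext i; simp
        have h2 : (Fin.cons (β 1 v) w : Fin 2 → K) ∘ Fin.succAbove 1 = ![β 1 v] := by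
          funext i; rw [Subsingleton.elim i 0]; rfl
        rw [h1, h2]
        simp [sub_eq_add_neg]
      rw [this, tupleDelta_sub]
      funext w
      simp [tupleDelta, Fin.sum_univ_two]
    exact congrFun h v
  | succ n ih =>
    funext v
    change tupleDelta (subdiv β (n + 1) (cone _ (tupleDelta φ))) v = _
    rw [cone_tupleDelta, subdiv_sub, ih, tupleDelta_sub, tupleDelta_tupleDelta, sub_zero]

/-- Subdivision is cochain homotopic to the identity. -/
theorem subdivHomotopy_tupleDelta (n : ℕ) (φ : (Fin (n + 2) → K) → ℤ) :
    subdivHomotopy β (n + 1) (tupleDelta φ) + tupleDelta (subdivHomotopy β n φ)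
      = φ - subdiv β (n + 1) φ := by
  induction n with
  | zero =>
    funext v
    have h : tupleDelta (0 : (Fin 1 → K) → ℤ) = 0 := tupleDelta_zero
    simp only [subdivHomotopy, Pi.add_apply, Pi.sub_apply, h, Pi.zero_apply, cone_tupleDelta,
      subdiv]
    ring
  | succ n ih =>
    funext v
    have h := ih (cone (β (n + 2) v) φ)
    rw [← eq_sub_iff_add_eq] at h
    change cone _ (tupleDelta φ) v - tupleDelta (subdivHomotopy β (n + 1) (cone _ (tupleDelta φ))) v
      + _ = φ v - tupleDelta (subdiv β (n + 1) (cone (β (n + 2) v) φ)) v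
    rw [cone_tupleDelta, subdivHomotopy_sub, tupleDelta_sub, h, tupleDelta_sub, tupleDelta_sub,
      tupleDelta_tupleDelta]
    simp only [Pi.sub_apply, Pi.zero_apply]
    ring

theorem tupleDelta_comp (a : K → L) (φ : (Fin (n + 1) → L) → ℤ) (v : Fin (n + 2) → K) :
    tupleDelta φ (a ∘ v) = tupleDelta (fun w => φ (a ∘ w)) v := rfl

theorem cone_comp (a : K → L) (b : K) (φ : (Fin (n + 2) → L) → ℤ) :
    (fun w => cone (a b) φ (a ∘ w)) = cone b (fun w => φ (a ∘ w)) := by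
  funext w
  simp only [cone]
  congr 1
  funext i
  refine Fin.cases ?_ (fun j => ?_) i <;> simp

/-- Subdivision is natural in maps that preserve the centres of simplices. -/
theorem subdiv_comp (a : K → L) (γ : (n : ℕ) → (Fin (n + 1) → L) → L)
    (h : ∀ n v, a (β n v) = γ n (a ∘ v)) (n : ℕ) (φ : (Fin (n + 1) → L) → ℤ) :
    (fun v => subdiv γ n φ (a ∘ v)) = subdiv β n (fun w => φ (a ∘ w)) := by
  induction n with
  | zero => rfl
  | succ n ih =>
    funext v
    simp only [subdiv]
    rw [tupleDelta_comp, ih, ← h, cone_comp]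

theorem subdivHomotopy_comp (a : K → L) (γ : (n : ℕ) → (Fin (n + 1) → L) → L)
    (h : ∀ n v, a (β n v) = γ n (a ∘ v)) (n : ℕ) (φ : (Fin (n + 2) → L) → ℤ) :
    (fun v => subdivHomotopy γ n φ (a ∘ v)) = subdivHomotopy β n (fun w => φ (a ∘ w)) := by
  induction n with
  | zero => rfl
  | succ n ih =>
    funext v
    simp only [subdivHomotopy]
    rw [tupleDelta_comp, ih, ← h, cone_comp, ← cone_comp a]

end Tuples

/-! ### Barycentric subdivision of singular cochains -/

section Affine

variable {n m N : ℕ}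

/-- The affine map from a standard simplex with prescribed values on the vertices. -/
def affineSimplex (v : Fin (n + 1) → stdSimplex ℝ (Fin (N + 1))) :
    C(stdSimplex ℝ (Fin (n + 1)), stdSimplex ℝ (Fin (N + 1))) where
  toFun x := ⟨∑ i, x.1 i • (v i).1, (convex_stdSimplex ℝ _).sum_mem (fun i _ => x.2.1 i) x.2.2
    fun i _ => (v i).2⟩
  continuous_toFun := Continuous.subtype_mk (continuous_finsetSum _ fun i _ =>
    ((continuous_apply i).comp continuous_subtype_val).smul continuous_const) _

theorem affineSimplex_val (v : Fin (n + 1) → stdSimplex ℝ (Fin (N + 1)))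
    (x : stdSimplex ℝ (Fin (n + 1))) : (affineSimplex v x).1 = ∑ i, x.1 i • (v i).1 := rfl

/-- The vertices of the standard simplex. -/
def vertices (n : ℕ) : Fin (n + 1) → stdSimplex ℝ (Fin (n + 1)) := stdSimplex.vertex

theorem affineSimplex_vertices : affineSimplex (vertices n) = ContinuousMap.id _ := by
  ext x j
  change (∑ i, x.1 i • (Pi.single i 1 : Fin (n + 1) → ℝ)) j = x.1 j
  simp [Finset.sum_apply, Pi.single_apply]

theorem affineSimplex_comp_vertices (v : Fin (n + 1) → stdSimplex ℝ (Fin (N + 1))) :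
    affineSimplex v ∘ vertices n = v := by
  funext j
  apply Subtype.ext
  change (∑ i, (Pi.single j 1 : Fin (n + 1) → ℝ) i • (v i).1) = (v j).1
  simp [Pi.single_apply]

theorem affineSimplex_comp_affineSimplex (v : Fin (n + 1) → stdSimplex ℝ (Fin (N + 1)))
    (w : Fin (m + 1) → stdSimplex ℝ (Fin (n + 1))) :
    (affineSimplex v).comp (affineSimplex w) = affineSimplex (affineSimplex v ∘ w) := by
  refine ContinuousMap.ext fun x => Subtype.ext ?_
  change ∑ i, (∑ j, x.1 j • (w j).1) i • (v i).1 = ∑ j, x.1 j • ∑ i, (w j).1 i • (v i).1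
  simp only [Finset.sum_apply, Finset.sum_smul, Finset.smul_sum, Pi.smul_apply, smul_smul,
    smul_eq_mul]
  exact Finset.sum_comm

theorem affineSimplex_comp_face (v : Fin (n + 2) → stdSimplex ℝ (Fin (N + 1)))
    (i : Fin (n + 2)) :
    (affineSimplex v).comp (face n i) = affineSimplex (v ∘ i.succAbove) := by
  have h : ∀ x, (affineSimplex v).comp (face n i) x = affineSimplex (v ∘ i.succAbove) x := by
    intro x
    apply Subtype.ext
    change ∑ j, (FunOnFinite.linearMap ℝ ℝ i.succAbove x.1) j • (v j).1
      = ∑ j, x.1 j • (v (i.succAbove j)).1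
    simp only [FunOnFinite.linearMap_apply_apply, Finset.sum_smul]
    rw [← Finset.sum_fiberwise Finset.univ i.succAbove]
    refine Finset.sum_congr rfl fun j _ => Finset.sum_congr rfl fun k hk => ?_
    rw [(Finset.mem_filter.1 hk).2]
  exact ContinuousMap.ext h

/-- The barycentre of a tuple of points of a standard simplex. -/
def bary (n : ℕ) (v : Fin (n + 1) → stdSimplex ℝ (Fin (N + 1))) : stdSimplex ℝ (Fin (N + 1)) :=
  affineSimplex v stdSimplex.barycenter

theorem affineSimplex_bary (v : Fin (n + 1) → stdSimplex ℝ (Fin (N + 1)))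
    (m : ℕ) (w : Fin (m + 1) → stdSimplex ℝ (Fin (n + 1))) :
    affineSimplex v (bary m w) = bary m (affineSimplex v ∘ w) := by
  unfold bary
  rw [← affineSimplex_comp_affineSimplex]
  rfl

end Affine

section Mesh

variable {N : ℕ}

theorem dist_le_of_mem_convexHull {n : ℕ} {v : Fin (n + 1) → Fin N → ℝ} {x y : Fin N → ℝ}
    {r : ℝ} (hx : x ∈ convexHull ℝ (Set.range v)) (h : ∀ i, dist (v i) y ≤ r) : dist x y ≤ r := by
  have : convexHull ℝ (Set.range v) ⊆ Metric.closedBall y r :=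
    convexHull_min (by rintro _ ⟨i, rfl⟩; exact h i) (convex_closedBall y r)
  exact this hx

theorem affineSimplex_mem_convexHull {n : ℕ} (v : Fin (n + 1) → stdSimplex ℝ (Fin (N + 1)))
    (x : stdSimplex ℝ (Fin (n + 1))) :
    (affineSimplex v x).1 ∈ convexHull ℝ (Set.range fun i => (v i).1) :=
  (convex_convexHull ℝ _).sum_mem (fun i _ => x.2.1 i) x.2.2
    fun i _ => subset_convexHull ℝ _ ⟨i, rfl⟩

/-- The barycentre of `n + 2` points at distance at most `d` from each other has distance at most
`(n + 1) / (n + 2) * d` from each of them. -/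
theorem dist_bary_le {n : ℕ} (v : Fin (n + 2) → stdSimplex ℝ (Fin (N + 1))) {d : ℝ}
    (h : ∀ i j, dist (v i).1 (v j).1 ≤ d) (j : Fin (n + 2)) :
    dist (v j).1 (bary (n + 1) v).1 ≤ (n + 1) / (n + 2) * d := by
  have e : (v j).1 - (bary (n + 1) v).1 = ∑ i, ((n + 2 : ℝ)⁻¹) • ((v j).1 - (v i).1) := by
    have : (bary (n + 1) v).1 = ∑ i, ((n + 2 : ℝ)⁻¹) • (v i).1 := by
      unfold bary
      rw [affineSimplex_val]
      refine Finset.sum_congr rfl fun i _ => ?_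
      rw [stdSimplex.barycenter_apply]
      congr 2
      simp
      ring
    rw [this]
    simp only [smul_sub, Finset.sum_sub_distrib]
    congr 1
    rw [Finset.sum_const, Finset.card_univ, Fintype.card_fin, ← Nat.cast_smul_eq_nsmul ℝ, smul_smul]
    push_cast
    rw [mul_inv_cancel₀ (by positivity), one_smul]
  rw [dist_eq_norm, e, ← Finset.sum_erase_add _ _ (Finset.mem_univ j)]
  rw [sub_self, smul_zero, add_zero]
  refine (norm_sum_le _ _).trans ?_
  refine (Finset.sum_le_card_nsmul _ _ ((n + 2 : ℝ)⁻¹ * d) fun i _ => ?_).trans (le_of_eq ?_)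
  · rw [norm_smul, ← dist_eq_norm, Real.norm_of_nonneg (by positivity)]
    exact mul_le_mul_of_nonneg_left (h j i) (by positivity)
  · rw [Finset.card_erase_of_mem (Finset.mem_univ j), Finset.card_univ, Fintype.card_fin,
      nsmul_eq_mul]
    push_cast
    ring

/-- Subdivision of an `n`-simplex multiplies the mesh by `n / (n + 1)`. In terms of cochains: the
subdivision of `φ` vanishes on `v` if `φ` vanishes on all simplices of this size in the convex hull
of `v`. -/
theorem subdiv_eq_zero_of_mesh (n : ℕ) (φ : (Fin (n + 1) → stdSimplex ℝ (Fin (N + 1))) → ℤ)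
    (v : Fin (n + 1) → stdSimplex ℝ (Fin (N + 1))) {d : ℝ}
    (hv : ∀ i j, dist (v i).1 (v j).1 ≤ d)
    (hφ : ∀ w : Fin (n + 1) → stdSimplex ℝ (Fin (N + 1)),
      (∀ i, (w i).1 ∈ convexHull ℝ (Set.range fun i => (v i).1)) →
      (∀ i j, dist (w i).1 (w j).1 ≤ n / (n + 1) * d) → φ w = 0) :
    subdiv bary n φ v = 0 := by
  have hd : 0 ≤ d := dist_nonneg.trans (hv 0 0)
  induction n with
  | zero =>
    refine hφ v (fun i => subset_convexHull ℝ _ ⟨i, rfl⟩) fun i j => ?_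
    rw [show i = j from Subsingleton.elim (α := Fin 1) i j, dist_self]
    simp
  | succ n ih =>
    simp only [subdiv, tupleDelta]
    refine Finset.sum_eq_zero fun i _ => ?_
    rw [ih, mul_zero]
    · exact fun a b => hv _ _
    intro w hw hwd
    have hw' : ∀ j, (w j).1 ∈ convexHull ℝ (Set.range fun i => (v i).1) := fun j =>
      convexHull_mono (by rintro _ ⟨k, rfl⟩; exact ⟨_, rfl⟩) (hw j)
    have hb : ∀ j, dist (w j).1 (bary (n + 1) v).1 ≤ (n + 1) / (n + 2) * d := fun j =>
      dist_le_of_mem_convexHull (hw' j) (dist_bary_le v hv)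
    have e : (((n + 1 : ℕ) : ℝ) / ((n + 1 : ℕ) + 1) * d) = (n + 1) / (n + 2) * d := by
      push_cast; ring
    have hle : (n / (n + 1) * d : ℝ) ≤ (n + 1) / (n + 2) * d := by
      refine mul_le_mul_of_nonneg_right ?_ hd
      rw [div_le_div_iff₀ (by positivity) (by positivity)]
      nlinarith
    refine hφ _ (fun j => ?_) fun j k => ?_
    · refine Fin.cases ?_ (fun j => ?_) j
      · exact affineSimplex_mem_convexHull v _
      · exact hw' j
    · rw [e]
      refine Fin.cases ?_ (fun j => ?_) j <;> refine Fin.cases ?_ (fun k => ?_) k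
      · rw [dist_self]; positivity
      · rw [dist_comm]; exact hb k
      · exact hb j
      · exact (hwd j k).trans hle

theorem iterate_subdiv_eq_zero (n : ℕ) {φ : (Fin (n + 1) → stdSimplex ℝ (Fin (N + 1))) → ℤ} {ε : ℝ}
    (hφ : ∀ w : Fin (n + 1) → stdSimplex ℝ (Fin (N + 1)),
      (∀ i j, dist (w i).1 (w j).1 ≤ ε) → φ w = 0) (k : ℕ) {d : ℝ}
    (hd : (n / (n + 1) : ℝ) ^ k * d ≤ ε) (v : Fin (n + 1) → stdSimplex ℝ (Fin (N + 1)))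
    (hv : ∀ i j, dist (v i).1 (v j).1 ≤ d) : (subdiv bary n)^[k] φ v = 0 := by
  induction k generalizing φ ε with
  | zero => exact hφ v fun i j => (hv i j).trans (by simpa using hd)
  | succ k ih =>
    rw [Function.iterate_succ_apply]
    refine ih (ε := (n / (n + 1) : ℝ) ^ k * d) (fun w hw => ?_) le_rfl
    refine subdiv_eq_zero_of_mesh n φ w hw fun u _ hu => hφ u fun i j => (hu i j).trans ?_
    rw [← mul_assoc, ← pow_succ']
    exact hd

end Mesh

section Subdivision

variable {X : Type} [TopologicalSpace X] {n N : ℕ}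

/-- The restriction of a singular cochain to the affine simplices of a singular simplex. -/
def onAffine (c : Simp X n → ℤ) (s : Simp X N)
    (v : Fin (n + 1) → stdSimplex ℝ (Fin (N + 1))) : ℤ :=
  c (s.comp (affineSimplex v))

theorem onAffine_vertices (c : Simp X n → ℤ) (s : Simp X n) : onAffine c s (vertices n) = c s := by
  rw [onAffine, affineSimplex_vertices, ContinuousMap.comp_id]

theorem onAffine_delta (c : Simp X n → ℤ) (s : Simp X N) :
    onAffine (delta c) s = tupleDelta (onAffine c s) := by
  funext v
  simp only [onAffine, delta, tupleDelta, ContinuousMap.comp_assoc, affineSimplex_comp_face]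

theorem onAffine_comp {M : ℕ} (c : Simp X n → ℤ) (s : Simp X N)
    (v : Fin (M + 1) → stdSimplex ℝ (Fin (N + 1))) :
    onAffine c (s.comp (affineSimplex v)) = fun w => onAffine c s (affineSimplex v ∘ w) := by
  funext w
  simp only [onAffine, ContinuousMap.comp_assoc, affineSimplex_comp_affineSimplex]

/-- Barycentric subdivision of singular cochains. -/
def singSubdiv (c : Simp X n → ℤ) (s : Simp X n) : ℤ :=
  subdiv bary n (onAffine c s) (vertices n)

/-- The natural homotopy between barycentric subdivision and the identity. -/
def singSubdivHomotopy (c : Simp X (n + 1) → ℤ) (s : Simp X n) : ℤ :=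
  subdivHomotopy bary n (onAffine c s) (vertices n)

theorem onAffine_singSubdiv (c : Simp X n → ℤ) (s : Simp X N) :
    onAffine (singSubdiv c) s = subdiv bary n (onAffine c s) := by
  funext v
  change subdiv bary n (onAffine c (s.comp (affineSimplex v))) (vertices n) = _
  rw [onAffine_comp, ← subdiv_comp bary (affineSimplex v) bary fun m w => affineSimplex_bary v m w]
  change subdiv bary n (onAffine c s) (affineSimplex v ∘ vertices n) = _
  rw [affineSimplex_comp_vertices]

theorem onAffine_singSubdivHomotopy (c : Simp X (n + 1) → ℤ) (s : Simp X N) :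
    onAffine (singSubdivHomotopy c) s = subdivHomotopy bary n (onAffine c s) := by
  funext v
  change subdivHomotopy bary n (onAffine c (s.comp (affineSimplex v))) (vertices n) = _
  rw [onAffine_comp,
    ← subdivHomotopy_comp bary (affineSimplex v) bary fun m w => affineSimplex_bary v m w]
  change subdivHomotopy bary n (onAffine c s) (affineSimplex v ∘ vertices n) = _
  rw [affineSimplex_comp_vertices]

theorem singSubdiv_delta (c : Simp X n → ℤ) : singSubdiv (delta c) = delta (singSubdiv c) := by
  funext s
  rw [← onAffine_vertices (delta _), onAffine_delta, onAffine_singSubdiv, ← subdiv_tupleDelta,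
    ← onAffine_delta]
  rfl

theorem singSubdivHomotopy_delta (c : Simp X (n + 1) → ℤ) :
    singSubdivHomotopy (delta c) + delta (singSubdivHomotopy c) = c - singSubdiv c := by
  funext s
  have h := congrFun (subdivHomotopy_tupleDelta bary n (onAffine c s)) (vertices (n + 1))
  rw [← onAffine_delta, ← onAffine_singSubdivHomotopy (delta c), ← onAffine_singSubdivHomotopy c,
    ← onAffine_delta, ← onAffine_singSubdiv, Pi.add_apply, Pi.sub_apply, onAffine_vertices,
    onAffine_vertices, onAffine_vertices, onAffine_vertices] at h
  exact h

theorem onAffine_iterate_singSubdiv (c : Simp X n → ℤ) (s : Simp X N) (k : ℕ) :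
    onAffine (singSubdiv^[k] c) s = (subdiv bary n)^[k] (onAffine c s) := by
  induction k generalizing c with
  | zero => rfl
  | succ k ih => rw [Function.iterate_succ_apply, Function.iterate_succ_apply, ih,
      onAffine_singSubdiv]

variable {ι : Type*} {U : ι → Set X}

/-- A cochain vanishes on the simplices that are small with respect to a family of subsets. -/
def VanishesOnSmall (U : ι → Set X) (c : Simp X n → ℤ) : Prop :=
  ∀ s : Simp X n, (∃ i, ∀ x, s x ∈ U i) → c s = 0

theorem VanishesOnSmall.onAffine_eq_zero {c : Simp X n → ℤ} (hc : VanishesOnSmall U c)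
    {s : Simp X N} (hs : ∃ i, ∀ x, s x ∈ U i) : onAffine c s = 0 := by
  obtain ⟨i, hi⟩ := hs
  exact funext fun v => hc _ ⟨i, fun x => hi _⟩

theorem subdiv_zero (n : ℕ) (K : Type*) (β : (n : ℕ) → (Fin (n + 1) → K) → K) :
    subdiv β n (0 : (Fin (n + 1) → K) → ℤ) = 0 := by
  simpa using subdiv_sub β n 0 0

theorem VanishesOnSmall.iterate_singSubdiv {c : Simp X n → ℤ} (hc : VanishesOnSmall U c) (k : ℕ) :
    VanishesOnSmall U (singSubdiv^[k] c) := by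
  induction k with
  | zero => exact hc
  | succ k ih =>
    intro s hs
    rw [Function.iterate_succ_apply', singSubdiv, ih.onAffine_eq_zero hs, subdiv_zero]
    rfl

theorem VanishesOnSmall.singSubdivHomotopy {c : Simp X (n + 1) → ℤ} (hc : VanishesOnSmall U c) :
    VanishesOnSmall U (singSubdivHomotopy c) := by
  intro s hs
  rw [SingularCohomology.singSubdivHomotopy, hc.onAffine_eq_zero hs, subdivHomotopy_zero]
  rfl

theorem dist_le_one_of_mem_stdSimplex {x y : Fin (N + 1) → ℝ} (hx : x ∈ stdSimplex ℝ (Fin (N + 1)))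
    (hy : y ∈ stdSimplex ℝ (Fin (N + 1))) : dist x y ≤ 1 :=
  (Metric.dist_le_diam_of_mem (bounded_stdSimplex _) hx hy).trans diam_stdSimplex_le

/-- After sufficiently many subdivisions, all affine simplices of a given singular simplex become
small. -/
theorem VanishesOnSmall.eventually_onAffine_eq_zero {c : Simp X n → ℤ} (hc : VanishesOnSmall U c)
    (hU : ∀ i, IsOpen (U i)) (hcov : ∀ x, ∃ i, x ∈ U i) (s : Simp X N) :
    ∃ M, ∀ k, M ≤ k → onAffine (singSubdiv^[k] c) s = 0 := by
  obtain ⟨ε, hε, H⟩ := lebesgue_number_lemma_of_metric (s := Set.univ)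
    (c := fun i => s ⁻¹' U i) isCompact_univ (fun i => (hU i).preimage s.continuous)
    (fun x _ => Set.mem_iUnion.2 (hcov (s x)))
  have h0 : ∀ w : Fin (n + 1) → stdSimplex ℝ (Fin (N + 1)),
      (∀ i j, dist (w i).1 (w j).1 ≤ ε / 2) → onAffine c s w = 0 := by
    intro w hw
    obtain ⟨i, hi⟩ := H (w 0) trivial
    refine hc _ ⟨i, fun x => hi ?_⟩
    have : dist (affineSimplex w x).1 (w 0).1 ≤ ε / 2 :=
      dist_le_of_mem_convexHull (affineSimplex_mem_convexHull w x) fun i => hw i 0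
    exact lt_of_le_of_lt this (by linarith)
  have hlt : (n / (n + 1) : ℝ) < 1 := by rw [div_lt_one (by positivity)]; linarith
  obtain ⟨M, hM⟩ := exists_pow_lt_of_lt_one (half_pos hε) hlt
  refine ⟨M, fun k hk => ?_⟩
  rw [onAffine_iterate_singSubdiv]
  funext v
  refine iterate_subdiv_eq_zero n h0 k (d := 1) ?_ v fun i j =>
    dist_le_one_of_mem_stdSimplex (v i).2 (v j).2
  rw [mul_one]
  exact (pow_le_pow_of_le_one (by positivity) hlt.le hk).trans hM.le

/-- **Small simplices theorem.** A cocycle that vanishes on the simplices contained in one of the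
members of an open cover is the coboundary of a cochain with the same property. -/
theorem VanishesOnSmall.exists_delta_eq {c : Simp X (n + 1) → ℤ} (hc : VanishesOnSmall U c)
    (hU : ∀ i, IsOpen (U i)) (hcov : ∀ x, ∃ i, x ∈ U i) (hδ : delta c = 0) :
    ∃ b : Simp X n → ℤ, VanishesOnSmall U b ∧ delta b = c := by
  have hδk : ∀ k, delta (singSubdiv^[k] c) = 0 := by
    intro k
    induction k with
    | zero => exact hδ
    | succ k ih =>
      rw [Function.iterate_succ_apply', ← singSubdiv_delta, ih]
      funext s
      change subdiv bary _ 0 _ = 0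
      rw [subdiv_zero]
      rfl
  -- `b` is the sum of the cochains `T (S^k c)` with `S` the subdivision and `T` the homotopy
  -- between `S` and the identity; only finitely many of the terms are nonzero on a given simplex
  choose M hM using fun s : Simp X n => hc.eventually_onAffine_eq_zero hU hcov s
  let b : Simp X n → ℤ := fun s =>
    ∑ k ∈ Finset.range (M s), SingularCohomology.singSubdivHomotopy (singSubdiv^[k] c) s
  have hb : ∀ s m, M s ≤ m →
      b s = ∑ k ∈ Finset.range m, SingularCohomology.singSubdivHomotopy (singSubdiv^[k] c) s := by
    intro s m hm
    refine Finset.sum_subset (Finset.range_subset_range.2 hm) fun k _ hk => ?_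
    rw [SingularCohomology.singSubdivHomotopy, hM s k (by simpa using hk), subdivHomotopy_zero]
    rfl
  refine ⟨b, fun s hs => Finset.sum_eq_zero fun k _ =>
    (hc.iterate_singSubdiv k).singSubdivHomotopy s hs, ?_⟩
  funext s
  obtain ⟨M', hM'⟩ := hc.eventually_onAffine_eq_zero hU hcov s
  let m := M' + ∑ i, M (s.comp (face n i))
  have hm : ∀ i, M (s.comp (face n i)) ≤ m := fun i =>
    (Finset.single_le_sum (fun i _ => Nat.zero_le (M (s.comp (face n i))))
      (Finset.mem_univ i)).trans (Nat.le_add_left _ _)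
  have e1 : delta b s = ∑ k ∈ Finset.range m,
      delta (SingularCohomology.singSubdivHomotopy (singSubdiv^[k] c)) s := by
    simp only [delta]
    rw [Finset.sum_comm]
    refine Finset.sum_congr rfl fun i _ => ?_
    rw [hb _ m (hm i), Finset.mul_sum]
  -- the terms telescope, since `S^k c` is a cocycle
  have e2 : ∀ k, delta (SingularCohomology.singSubdivHomotopy (singSubdiv^[k] c)) s
      = (singSubdiv^[k] c) s - (singSubdiv^[k + 1] c) s := by
    intro k
    have h := congrFun (singSubdivHomotopy_delta (singSubdiv^[k] c)) s
    have h0 : SingularCohomology.singSubdivHomotopy (delta (singSubdiv^[k] c)) s = 0 := by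
      rw [hδk]
      change subdivHomotopy bary _ 0 _ = 0
      rw [subdivHomotopy_zero]
      rfl
    rw [Pi.add_apply, h0, zero_add] at h
    rw [h, Function.iterate_succ_apply']
    rfl
  rw [e1, Finset.sum_congr rfl fun k _ => e2 k, Finset.sum_range_sub']
  have : (singSubdiv^[m] c) s = 0 := by
    rw [← onAffine_vertices (singSubdiv^[m] c) s, hM' m (Nat.le_add_right _ _)]
    rfl
  rw [this, sub_zero]
  rfl

end Subdivision

/-! ### Mayer–Vietoris arguments -/

section MayerVietoris

variable {X Y : Type} [TopologicalSpace X] [TopologicalSpace Y] {n : ℕ}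

/-- The cohomology of `X` vanishes in degree `n + 1`. The shift makes the degree positive, so that
no condition on constants is needed. -/
def Acyclic (X : Type) [TopologicalSpace X] (n : ℕ) : Prop :=
  ∀ c : Simp X (n + 1) → ℤ, delta c = 0 → ∃ b : Simp X n → ℤ, delta b = c

/-- A cochain vanishes on all simplices contained in `A`. -/
def VanishesOn (A : Set X) (c : Simp X n → ℤ) : Prop := ∀ s : Simp X n, (∀ x, s x ∈ A) → c s = 0

theorem VanishesOn.mono {A B : Set X} (h : A ⊆ B) {c : Simp X n → ℤ} (hc : VanishesOn B c) :
    VanishesOn A c := fun s hs => hc s fun x => h (hs x)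

theorem VanishesOn.add {A : Set X} {c d : Simp X n → ℤ} (hc : VanishesOn A c)
    (hd : VanishesOn A d) : VanishesOn A (c + d) := fun s hs => by
  rw [Pi.add_apply, hc s hs, hd s hs, add_zero]

theorem VanishesOn.sub {A : Set X} {c d : Simp X n → ℤ} (hc : VanishesOn A c)
    (hd : VanishesOn A d) : VanishesOn A (c - d) := fun s hs => by
  rw [Pi.sub_apply, hc s hs, hd s hs, sub_zero]

theorem VanishesOn.delta {A : Set X} {c : Simp X n → ℤ} (hc : VanishesOn A c) :
    VanishesOn A (delta c) := fun s hs =>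
  Finset.sum_eq_zero fun i _ => by rw [hc _ fun x => hs _, mul_zero]

theorem vanishesOn_univ {c : Simp X n → ℤ} (h : VanishesOn Set.univ c) : c = 0 :=
  funext fun s => h s fun _ => trivial

theorem VanishesOn.sum {A : Set X} {ι : Type*} {t : Finset ι} {c : ι → Simp X n → ℤ}
    (hc : ∀ i ∈ t, VanishesOn A (c i)) : VanishesOn A (∑ i ∈ t, c i) := fun s hs => by
  rw [Finset.sum_apply]
  exact Finset.sum_eq_zero fun i hi => hc i hi s hs

/-- Pull-back of cochains along a continuous map. -/
def comap (f : C(X, Y)) (c : Simp Y n → ℤ) : Simp X n → ℤ := fun s => c (f.comp s)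

theorem delta_comap (f : C(X, Y)) (c : Simp Y n → ℤ) : delta (comap f c) = comap f (delta c) := rfl

theorem comap_sub (f : C(X, Y)) (c d : Simp Y n → ℤ) :
    comap f (c - d) = comap f c - comap f d := rfl

theorem comap_sum (f : C(X, Y)) {ι : Type*} (t : Finset ι) (c : ι → Simp Y n → ℤ) :
    comap f (∑ i ∈ t, c i) = ∑ i ∈ t, comap f (c i) := by
  funext s
  simp [comap, Finset.sum_apply]

theorem comap_comap {Z : Type} [TopologicalSpace Z] (f : C(X, Y)) (g : C(Y, Z))
    (c : Simp Z n → ℤ) : comap f (comap g c) = comap (g.comp f) c := rfl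

theorem VanishesOn.comap {A : Set Y} {c : Simp Y n → ℤ} (hc : VanishesOn A c) (f : C(X, Y))
    {B : Set X} (h : ∀ x ∈ B, f x ∈ A) : VanishesOn B (comap f c) :=
  fun _ hs => hc _ fun x => h _ (hs x)

/-- The inclusion of a subspace. -/
def incl (A : Set X) : C(A, X) := ⟨Subtype.val, continuous_subtype_val⟩

/-- A simplex contained in a subspace, as a simplex of the subspace. -/
def codRestrict {A : Set X} (s : Simp X n) (h : ∀ x, s x ∈ A) : Simp A n :=
  ⟨fun x => ⟨s x, h x⟩, by fun_prop⟩

theorem comap_incl_eq_zero {A : Set X} {c : Simp X n → ℤ} :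
    comap (incl A) c = 0 ↔ VanishesOn A c :=
  ⟨fun h s hs => congrFun h (codRestrict s hs),
    fun h => funext fun _ => h _ fun _ => Subtype.prop _⟩

open Classical in
/-- Extension by zero of a cochain on a subspace. -/
def extendZero {A : Set X} (c : Simp A n → ℤ) (s : Simp X n) : ℤ :=
  if h : ∀ x, s x ∈ A then c (codRestrict s h) else 0

theorem comap_extendZero {A : Set X} (c : Simp A n → ℤ) : comap (incl A) (extendZero c) = c := by
  funext s
  exact dif_pos fun x => (s x).2

/-- Vanishing of the cohomology of a subspace in terms of cochains on the whole space. -/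
theorem Acyclic.exists_vanishesOn {A : Set X} (hA : Acyclic A n) {c : Simp X (n + 1) → ℤ}
    (hc : VanishesOn A (delta c)) : ∃ b : Simp X n → ℤ, VanishesOn A (c - delta b) := by
  obtain ⟨b, hb⟩ := hA (comap (incl A) c) (by rw [delta_comap]; exact comap_incl_eq_zero.2 hc)
  refine ⟨extendZero b, comap_incl_eq_zero.1 ?_⟩
  rw [comap_sub, ← delta_comap, comap_extendZero, hb, sub_self]

theorem Acyclic.of_exists_vanishesOn {A : Set X}
    (h : ∀ c : Simp X (n + 1) → ℤ, VanishesOn A (delta c) →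
      ∃ b : Simp X n → ℤ, VanishesOn A (c - delta b)) : Acyclic A n := by
  intro c hc
  obtain ⟨b, hb⟩ := h (extendZero c) (comap_incl_eq_zero.1 (by
    rw [← delta_comap, comap_extendZero, hc]))
  refine ⟨comap (incl A) b, ?_⟩
  rw [← comap_incl_eq_zero, comap_sub, comap_extendZero, ← delta_comap, sub_eq_zero] at hb
  exact hb.symm

/-- Vanishing of cohomology passes to homotopy retracts. -/
theorem Acyclic.of_homotopic (f : C(X, Y)) (g : C(Y, X))
    (h : (g.comp f).Homotopic (ContinuousMap.id X)) (hY : Acyclic Y n) : Acyclic X n := by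
  intro c hc
  obtain ⟨b, hb⟩ := hY (comap g c) (by rw [delta_comap, hc]; rfl)
  obtain ⟨b', hb'⟩ := exists_delta_eq_of_homotopic h c hc
  refine ⟨comap f b - b', ?_⟩
  rw [delta_sub, delta_comap, hb, hb']
  funext s
  change c ((g.comp f).comp s) - (c ((g.comp f).comp s) - c s) = c s
  ring

theorem pathConnectedSpace_of_homotopic (f : C(X, Y)) (g : C(Y, X))
    (h : (g.comp f).Homotopic (ContinuousMap.id X)) [PathConnectedSpace Y] :
    PathConnectedSpace X := by
  obtain ⟨H⟩ := h
  refine ⟨⟨g (Classical.arbitrary Y)⟩, fun x y => ?_⟩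
  have hx : ∀ x, Joined (g (f x)) x := fun x => ⟨H.evalAt x⟩
  exact (hx x).symm.trans (((PathConnectedSpace.joined (f x) (f y)).map g.continuous).trans (hx y))

/-- The small simplices theorem for a cover by two open sets. -/
theorem exists_delta_eq_of_cover {A B : Set X} (hA : IsOpen A) (hB : IsOpen B)
    (hAB : A ∪ B = Set.univ) {c : Simp X (n + 1) → ℤ} (hc : delta c = 0)
    (hcA : VanishesOn A c) (hcB : VanishesOn B c) :
    ∃ b : Simp X n → ℤ, VanishesOn A b ∧ VanishesOn B b ∧ delta b = c := by
  obtain ⟨b, hb, hbc⟩ := VanishesOnSmall.exists_delta_eq (U := fun i : Bool => cond i A B) (c := c)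
    (fun s ⟨i, hi⟩ => by cases i; exacts [hcB s hi, hcA s hi])
    (fun i => by cases i; exacts [hB, hA])
    (fun x => (hAB.symm ▸ Set.mem_univ x : x ∈ A ∪ B).elim (fun h => ⟨true, h⟩)
      fun h => ⟨false, h⟩) hc
  exact ⟨b, fun s hs => hb s ⟨true, hs⟩, fun s hs => hb s ⟨false, hs⟩, hbc⟩

/-- A cochain that is closed on both members of an open cover can be changed to a closed one without
changing its values on the simplices contained in one of the members. -/
theorem exists_closed_of_cover {A B : Set X} (hA : IsOpen A) (hB : IsOpen B)
    (hAB : A ∪ B = Set.univ) {c : Simp X n → ℤ} (hcA : VanishesOn A (delta c))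
    (hcB : VanishesOn B (delta c)) :
    ∃ b : Simp X n → ℤ, VanishesOn A b ∧ VanishesOn B b ∧ delta (c - b) = 0 := by
  obtain ⟨b, hbA, hbB, hb⟩ := exists_delta_eq_of_cover hA hB hAB (delta_delta c) hcA hcB
  exact ⟨b, hbA, hbB, by rw [delta_sub, hb, sub_self]⟩

open Classical in
/-- The part of a cochain supported on the simplices contained in `A`. -/
def supportedIn (A : Set X) (c : Simp X n → ℤ) (s : Simp X n) : ℤ :=
  if ∀ x, s x ∈ A then c s else 0

theorem vanishesOn_sub_supportedIn (A : Set X) (c : Simp X n → ℤ) :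
    VanishesOn A (c - supportedIn A c) := fun s hs => by
  rw [Pi.sub_apply, supportedIn, if_pos hs, sub_self]

theorem vanishesOn_supportedIn {A B : Set X} {c : Simp X n → ℤ} (hc : VanishesOn (A ∩ B) c) :
    VanishesOn B (supportedIn A c) := fun s hs => by
  rw [supportedIn]
  split_ifs with h
  · exact hc s fun x => ⟨h x, hs x⟩
  · rfl

/-- Excision: a cocycle vanishing on `A ∩ B` is the sum of cocycles vanishing on `A` and on `B`. -/
theorem exists_add_of_vanishesOn_inter {A B : Set X} (hA : IsOpen A) (hB : IsOpen B)
    (hAB : A ∪ B = Set.univ) {z : Simp X n → ℤ} (hz : delta z = 0)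
    (hzAB : VanishesOn (A ∩ B) z) :
    ∃ a b : Simp X n → ℤ, z = a + b ∧ delta a = 0 ∧ delta b = 0 ∧ VanishesOn A a ∧
      VanishesOn B b := by
  have h1 := vanishesOn_sub_supportedIn A z
  have h2 : VanishesOn B (supportedIn A z) := vanishesOn_supportedIn hzAB
  have h3 : delta (z - supportedIn A z) = - delta (supportedIn A z) := by
    rw [delta_sub, hz, zero_sub]
  obtain ⟨k, hkA, hkB, hk⟩ := exists_closed_of_cover hA hB hAB h1.delta
    (fun s hs => by rw [h3, Pi.neg_apply, h2.delta s hs, neg_zero])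
  refine ⟨z - supportedIn A z - k, supportedIn A z + k, by abel, hk, ?_, h1.sub hkA, h2.add hkB⟩
  rw [show supportedIn A z + k = z - (z - supportedIn A z - k) by abel, delta_sub, hz, hk, sub_zero]

/-- If a coboundary of a cochain vanishing on `A ∩ B` is the sum of cocycles vanishing on `A` and
on `B`, then these are coboundaries of cochains vanishing on `A` and on `B`. -/
theorem exists_delta_eq_of_delta_eq_add {A B : Set X} (hA : IsOpen A) (hB : IsOpen B)
    (hAB : A ∪ B = Set.univ) {b : Simp X n → ℤ} (hb : VanishesOn (A ∩ B) b)
    {d e : Simp X (n + 1) → ℤ} (hde : delta b = d + e) (he : delta e = 0)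
    (hdA : VanishesOn A d) (heB : VanishesOn B e) :
    ∃ c : Simp X n → ℤ, VanishesOn B c ∧ delta c = e := by
  have h1 := vanishesOn_sub_supportedIn A b
  have h2 : VanishesOn B (supportedIn A b) := vanishesOn_supportedIn hb
  have h3 : e - delta (supportedIn A b) = delta (b - supportedIn A b) - d := by
    rw [delta_sub, hde]; abel
  obtain ⟨k, hkA, hkB, hk⟩ := exists_delta_eq_of_cover hA hB hAB
    (c := e - delta (supportedIn A b)) (by rw [delta_sub, he, delta_delta, sub_zero])
    (by rw [h3]; exact h1.delta.sub hdA) (heB.sub h2.delta)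
  exact ⟨supportedIn A b + k, h2.add hkB, by rw [delta_add, hk]; abel⟩

/-- One half of the Mayer–Vietoris argument: the cohomology of `X = A ∪ B` vanishes in degree
`n + 1` if that of `A` and of `B` does and every `n`-cocycle on `A ∩ B` extends to `X`. The last
condition holds if the cohomology of `A ∩ B` vanishes in degree `n > 0`, and for `n = 0` if `A ∩ B`
is path-connected. -/
theorem acyclic_of_cover {A B : Set X} (hA : IsOpen A) (hB : IsOpen B) (hAB : A ∪ B = Set.univ)
    (hA' : Acyclic A n) (hB' : Acyclic B n)
    (h : ∀ c : Simp X n → ℤ, VanishesOn (A ∩ B) (delta c) →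
      ∃ e : Simp X n → ℤ, delta e = 0 ∧ VanishesOn (A ∩ B) (c - e)) : Acyclic X n := by
  intro c hc
  obtain ⟨a, ha⟩ := hA'.exists_vanishesOn (c := c) (by rw [hc]; exact fun _ _ => rfl)
  obtain ⟨b, hb⟩ := hB'.exists_vanishesOn (c := c) (by rw [hc]; exact fun _ _ => rfl)
  obtain ⟨e, he, hae⟩ := h (a - b) (by
    rw [delta_sub, show delta a - delta b = (c - delta b) - (c - delta a) by abel]
    exact (hb.mono Set.inter_subset_right).sub (ha.mono Set.inter_subset_left))
  -- the cochain that agrees with `a` on `A` and with `b + e` on `B`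
  let g := b + e + supportedIn A (a - b - e)
  have h1 : VanishesOn A (c - delta g) := by
    rw [show c - delta g = (c - delta a) + delta (a - b - e - supportedIn A (a - b - e)) by
      simp only [g, delta_add, delta_sub]; abel]
    exact ha.add (vanishesOn_sub_supportedIn A _).delta
  have h2 : VanishesOn B (c - delta g) := by
    rw [show c - delta g = (c - delta b) - delta (supportedIn A (a - b - e)) by
      simp only [g, delta_add, he]; abel]
    exact hb.sub (vanishesOn_supportedIn hae).delta
  obtain ⟨k, -, -, hk⟩ := exists_delta_eq_of_cover hA hB hAB
    (by rw [delta_sub, hc, delta_delta, sub_zero]) h1 h2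
  exact ⟨g + k, by rw [delta_add, hk]; abel⟩

theorem Acyclic.of_cover_succ {A B : Set X} (hA : IsOpen A) (hB : IsOpen B)
    (hAB : A ∪ B = Set.univ) (hA' : Acyclic A (n + 1)) (hB' : Acyclic B (n + 1))
    (hi : Acyclic (A ∩ B : Set X) n) : Acyclic X (n + 1) :=
  acyclic_of_cover hA hB hAB hA' hB' fun _ hc =>
    let ⟨b, hb⟩ := hi.exists_vanishesOn hc
    ⟨delta b, delta_delta b, hb⟩

/-- If the cohomology of `X = A ∪ B` vanishes in degree `n + 1`, then a cocycle on `A ∩ B` of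
degree `n` is the difference of a cocycle on `B` and a cocycle on `A`, here `w` and `w - c`. -/
theorem Acyclic.exists_closed_on_cover (hX : Acyclic X n) {A B : Set X} (hA : IsOpen A)
    (hB : IsOpen B) (hAB : A ∪ B = Set.univ) {c : Simp X n → ℤ}
    (hc : VanishesOn (A ∩ B) (delta c)) :
    ∃ w : Simp X n → ℤ, VanishesOn A (delta (w - c)) ∧ VanishesOn B (delta w) := by
  have h1 := vanishesOn_sub_supportedIn A (delta c)
  have h2 : VanishesOn B (supportedIn A (delta c)) := vanishesOn_supportedIn hc
  obtain ⟨k, hkA, hkB, hk⟩ := exists_closed_of_cover hA hB hAB (c := supportedIn A (delta c))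
    (fun s hs => by
      have := h1.delta s hs
      rw [delta_sub, delta_delta, zero_sub, Pi.neg_apply, neg_eq_zero] at this
      exact this) h2.delta
  obtain ⟨w, hw⟩ := hX _ hk
  refine ⟨w, fun s hs => ?_, fun s hs => ?_⟩
  · have := h1 s hs
    rw [Pi.sub_apply] at this
    rw [delta_sub, hw, Pi.sub_apply, Pi.sub_apply, hkA s hs]
    omega
  · rw [hw, Pi.sub_apply, h2 s hs, hkB s hs, sub_zero]

theorem Acyclic.inter_of_cover (hX : Acyclic X (n + 1)) {A B : Set X} (hA : IsOpen A)
    (hB : IsOpen B) (hAB : A ∪ B = Set.univ) (hA' : Acyclic A n) (hB' : Acyclic B n) :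
    Acyclic (A ∩ B : Set X) n := by
  refine Acyclic.of_exists_vanishesOn fun c hc => ?_
  obtain ⟨w, hwA, hwB⟩ := hX.exists_closed_on_cover hA hB hAB hc
  obtain ⟨a, ha⟩ := hA'.exists_vanishesOn hwA
  obtain ⟨b, hb⟩ := hB'.exists_vanishesOn hwB
  refine ⟨b - a, ?_⟩
  rw [show c - delta (b - a) = (w - delta b) - (w - c - delta a) by rw [delta_sub]; abel]
  exact (hb.mono Set.inter_subset_right).sub (ha.mono Set.inter_subset_left)

end MayerVietoris

/-! ### Cohomology in degree zero and path-connectedness -/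

section DegreeZero

variable {X Y : Type} [TopologicalSpace X] [TopologicalSpace Y]

/-- The constant `0`-simplex at a point. -/
def pt (x : X) : Simp X 0 := ContinuousMap.const _ x

theorem eq_pt (s : Simp X 0) (t : stdSimplex ℝ (Fin 1)) : s = pt (s t) :=
  ContinuousMap.ext fun u => congrArg s (Subsingleton.elim u t)

theorem delta_apply_one (c : Simp X 0 → ℤ) (s : Simp X 1) :
    delta c s = c (pt (s (stdSimplex.vertex (1 : Fin 2))))
      - c (pt (s (stdSimplex.vertex (0 : Fin 2)))) := by
  have h : ∀ i : Fin 2, s.comp (face 0 i)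
      = pt (s (stdSimplex.vertex (i.succAbove (0 : Fin 1)))) := by
    intro i
    rw [eq_pt (s.comp (face 0 i)) (stdSimplex.vertex (0 : Fin 1))]
    exact congrArg (fun u => pt (s u)) (stdSimplex.map_vertex (S := ℝ) i.succAbove (0 : Fin 1))
  change ∑ i : Fin 2, (-1) ^ i.val * c (s.comp (face 0 i)) = _
  rw [Fin.sum_univ_two, h, h]
  simp [sub_eq_add_neg]

/-- A `0`-cocycle on `A` is constant along paths in `A`. -/
theorem eq_of_joinedIn_of_vanishesOn {A : Set X} {c : Simp X 0 → ℤ} (hc : VanishesOn A (delta c))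
    {x y : X} (h : JoinedIn A x y) : c (pt x) = c (pt y) := by
  obtain ⟨γ, hγ⟩ := h
  let s : Simp X 1 := γ.toContinuousMap.comp
    ⟨stdSimplexHomeomorphUnitInterval, stdSimplexHomeomorphUnitInterval.continuous⟩
  have h := hc s fun t => hγ _
  rw [delta_apply_one, sub_eq_zero] at h
  have h1 : s (stdSimplex.vertex (0 : Fin 2)) = x ∧ s (stdSimplex.vertex (1 : Fin 2)) = y := by
    change γ (stdSimplexHomeomorphUnitInterval _) = x ∧ γ (stdSimplexHomeomorphUnitInterval _) = y
    simp
  rw [h1.1, h1.2] at h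
  exact h.symm

/-- A `0`-cocycle on a path-connected set is constant. -/
theorem exists_const_of_isPathConnected {A : Set X} {c : Simp X 0 → ℤ}
    (hc : VanishesOn A (delta c)) (hA : IsPathConnected A) :
    ∃ m : ℤ, VanishesOn A (c - fun _ => m) := by
  obtain ⟨x, -, hx⟩ := hA
  refine ⟨c (pt x), fun s hs => ?_⟩
  rw [Pi.sub_apply, sub_eq_zero, eq_pt s (stdSimplex.vertex (0 : Fin 1))]
  exact (eq_of_joinedIn_of_vanishesOn hc (hx (hs _))).symm

theorem delta_const_zero (m : ℤ) : delta (fun _ : Simp X 0 => m) = 0 := by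
  funext s
  rw [delta_apply_one, sub_self]
  rfl

theorem Acyclic.of_cover_zero {A B : Set X} (hA : IsOpen A) (hB : IsOpen B)
    (hAB : A ∪ B = Set.univ) (hA' : Acyclic A 0) (hB' : Acyclic B 0)
    (hi : IsPathConnected (A ∩ B)) : Acyclic X 0 :=
  acyclic_of_cover hA hB hAB hA' hB' fun _ hc =>
    let ⟨m, hm⟩ := exists_const_of_isPathConnected hc hi
    ⟨_, delta_const_zero m, hm⟩

/-- If `X = A ∪ B` has no cohomology in degree one and `A` and `B` are path-connected, then so is
`A ∩ B`: every `0`-cocycle on `A ∩ B` is constant, in particular the indicator function of a path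
component. -/
theorem Acyclic.isPathConnected_inter (hX : Acyclic X 0) {A B : Set X} (hA : IsOpen A)
    (hB : IsOpen B) (hAB : A ∪ B = Set.univ) (hA' : IsPathConnected A) (hB' : IsPathConnected B)
    (hne : (A ∩ B).Nonempty) : IsPathConnected (A ∩ B) := by
  classical
  obtain ⟨x, hx⟩ := hne
  refine ⟨x, hx, fun {y} hy => ?_⟩
  -- the characteristic function of the path component of `x` in `A ∩ B` is a cocycle there
  let c : Simp X 0 → ℤ := fun s =>
    if JoinedIn (A ∩ B) x (s (stdSimplex.vertex (0 : Fin 1))) then 1 else 0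
  have hc : VanishesOn (A ∩ B) (delta c) := by
    intro s hs
    have hj : JoinedIn (A ∩ B) (s (stdSimplex.vertex (0 : Fin 2)))
        (s (stdSimplex.vertex (1 : Fin 2))) := by
      obtain ⟨γ⟩ := PathConnectedSpace.joined (stdSimplex.vertex 0 : stdSimplex ℝ (Fin 2))
        (stdSimplex.vertex 1)
      exact ⟨γ.map s.continuous, fun t => hs _⟩
    rw [delta_apply_one, sub_eq_zero]
    have : JoinedIn (A ∩ B) x (s (stdSimplex.vertex (1 : Fin 2)))
        ↔ JoinedIn (A ∩ B) x (s (stdSimplex.vertex (0 : Fin 2))) :=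
      ⟨fun h => h.trans hj.symm, fun h => h.trans hj⟩
    exact if_congr this rfl rfl
  obtain ⟨w, hwA, hwB⟩ := hX.exists_closed_on_cover hA hB hAB hc
  obtain ⟨a, ha⟩ := exists_const_of_isPathConnected hwA hA'
  obtain ⟨b, hb⟩ := exists_const_of_isPathConnected hwB hB'
  have key : ∀ u ∈ A ∩ B, c (pt u) = b - a := by
    intro u hu
    have h1 := ha (pt u) fun _ => hu.1
    have h2 := hb (pt u) fun _ => hu.2
    simp only [Pi.sub_apply] at h1 h2
    omega
  have h1 : c (pt x) = 1 := if_pos (JoinedIn.refl hx)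
  by_contra hn
  have h2 : c (pt y) = 0 := if_neg hn
  have := key x hx
  have := key y hy
  omega

end DegreeZero

/-- A point has no cohomology in positive degrees. -/
theorem acyclic_punit (n : ℕ) : Acyclic PUnit n := by
  have hsub : ∀ m (s t : Simp PUnit m), s = t := fun m _ _ => ContinuousMap.ext fun _ => rfl
  have hδ : ∀ m (c : Simp PUnit m → ℤ) (s : Simp PUnit (m + 1)) (t : Simp PUnit m),
      delta c s = (∑ i ∈ Finset.range (m + 2), (-1) ^ i) * c t := by
    intro m c s t
    rw [Finset.sum_mul, ← Fin.sum_univ_eq_sum_range (fun i => (-1) ^ i * c t) (m + 2)]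
    exact Finset.sum_congr rfl fun i _ => by rw [hsub _ (s.comp _) t]
  intro c hc
  let t : Simp PUnit n := ContinuousMap.const _ PUnit.unit
  let u : Simp PUnit (n + 1) := ContinuousMap.const _ PUnit.unit
  have h0 := congrFun hc (ContinuousMap.const _ PUnit.unit)
  rw [hδ _ c _ u, Pi.zero_apply] at h0
  rcases Nat.even_or_odd n with hn | hn
  · refine ⟨0, ?_⟩
    rw [neg_one_geom_sum, if_neg (by
      rw [Nat.not_even_iff_odd]; exact Even.add_one (hn.add (by decide : Even 2))), one_mul] at h0
    rw [delta_zero]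
    funext s
    rw [hsub _ s u, h0]
    rfl
  · refine ⟨fun _ => c u, ?_⟩
    funext s
    rw [hδ _ _ _ t, neg_one_geom_sum, if_neg (by
      rw [Nat.not_even_iff_odd]; exact hn.add_even (by decide : Even 2)), one_mul, hsub _ s u]

/-! ### Cohomology of punctured vector spaces and of the three-sphere -/

section Punctured

/-- A vector space without its origin. -/
abbrev Punctured (V : Type) [Zero V] : Type := {v : V // v ≠ 0}

variable (Y V : Type) [AddCommGroup V] {n : ℕ}

/-- The complement in `Y × (V × ℝ ∖ 0)` of the ray of points `(0, t)` with `t` of sign `-ε`. -/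
def offRay (ε : ℝ) : Set (Y × Punctured (V × ℝ)) := {x | x.2.1.1 ≠ 0 ∨ 0 < ε * x.2.1.2}

variable {Y V}

theorem offRay_union : offRay Y V 1 ∪ offRay Y V (-1) = Set.univ := by
  refine Set.eq_univ_of_forall fun x => ?_
  rcases x with ⟨y, ⟨v, t⟩, h⟩
  by_cases hv : v = 0
  · have ht : t ≠ 0 := fun ht => h (by rw [hv, ht]; rfl)
    rcases lt_or_gt_of_ne ht with ht | ht
    · exact Or.inr (Or.inr (by simpa using ht))
    · exact Or.inl (Or.inr (by simpa using ht))
  · exact Or.inl (Or.inl hv)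

theorem mem_offRay_inter {x : Y × Punctured (V × ℝ)} :
    x ∈ offRay Y V 1 ∩ offRay Y V (-1) ↔ x.2.1.1 ≠ 0 := by
  refine ⟨fun ⟨h1, h2⟩ => ?_, fun h => ⟨Or.inl h, Or.inl h⟩⟩
  rcases h1 with h1 | h1
  · exact h1
  · rcases h2 with h2 | h2
    · exact h2
    · linarith

variable [TopologicalSpace Y] [TopologicalSpace V]

theorem isOpen_offRay [T1Space V] (ε : ℝ) : IsOpen (offRay Y V ε) := by
  refine IsOpen.union ?_ ?_
  · exact isOpen_ne.preimage (f := fun x : Y × Punctured (V × ℝ) => x.2.1.1) (by fun_prop)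
  · exact isOpen_lt (f := fun _ : Y × Punctured (V × ℝ) => (0 : ℝ)) (by fun_prop) (by fun_prop)

/-- The projection of the complement of the ray to the parameter space. -/
def offRayProj (ε : ℝ) : C(offRay Y V ε, Y) := ⟨fun x => x.1.1, by fun_prop⟩

/-- The section of `offRayProj` with values in the opposite ray. -/
def offRaySection {ε : ℝ} (hε : ε * ε = 1) : C(Y, offRay Y V ε) :=
  ⟨fun y => ⟨(y, ⟨(0, ε), fun h => by
    rw [Prod.mk_eq_zero] at h
    rw [h.2, mul_zero] at hε
    exact zero_ne_one hε⟩), Or.inr (by change 0 < ε * ε; rw [hε]; exact one_pos)⟩, by fun_prop⟩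

/-- The projection from the complement of both rays. -/
def offRaysProj : C((offRay Y V 1 ∩ offRay Y V (-1) : Set _), Y × Punctured V) :=
  ⟨fun x => (x.1.1, ⟨x.1.2.1.1, mem_offRay_inter.1 x.2⟩), by fun_prop⟩

/-- The inclusion of the equator in the complement of both rays. -/
def offRaysSection : C(Y × Punctured V, (offRay Y V 1 ∩ offRay Y V (-1) : Set _)) :=
  ⟨fun x => ⟨(x.1, ⟨(x.2.1, 0), fun h => x.2.2 (Prod.mk_eq_zero.1 h).1⟩),
    mem_offRay_inter.2 x.2.2⟩, by fun_prop⟩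

theorem offRaysProj_comp_section :
    (offRaysProj (Y := Y) (V := V)).comp offRaysSection = ContinuousMap.id _ := rfl

theorem offRays_homotopic :
    (offRaysSection.comp (offRaysProj (Y := Y) (V := V))).Homotopic (ContinuousMap.id _) := by
  refine ⟨⟨⟨fun z => ⟨(z.2.1.1, ⟨(z.2.1.2.1.1, (z.1 : ℝ) * z.2.1.2.1.2), fun h =>
    mem_offRay_inter.1 z.2.2 (Prod.mk_eq_zero.1 h).1⟩), mem_offRay_inter.2
      (mem_offRay_inter.1 z.2.2 :)⟩, ?_⟩, ?_, ?_⟩⟩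
  · fun_prop
  · intro x
    refine Subtype.ext (Prod.ext rfl (Subtype.ext (Prod.ext rfl ?_)))
    simp [offRaysSection]
  · intro x
    refine Subtype.ext (Prod.ext rfl (Subtype.ext (Prod.ext rfl ?_)))
    simp

variable [Module ℝ V] [ContinuousSMul ℝ V]

/-- The complement of a ray is contracted linearly to the point on the opposite ray. -/
theorem offRay_homotopic {ε : ℝ} (hε : ε * ε = 1) :
    ((offRaySection hε).comp (offRayProj (Y := Y) (V := V) ε)).Homotopic (ContinuousMap.id _) := by
  have key : ∀ (t : I) (x : offRay Y V ε),
      ((t : ℝ) • x.1.2.1.1 ≠ 0 ∨ 0 < ε * ((t : ℝ) * x.1.2.1.2 + (1 - t) * ε)) := by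
    rintro t ⟨x, hx⟩
    have e : ε * ((t : ℝ) * x.2.1.2 + (1 - t) * ε) = t * (ε * x.2.1.2) + (1 - t) := by
      linear_combination (1 - (t : ℝ)) * hε
    rw [e]
    rcases eq_or_lt_of_le t.2.1 with h0 | h0
    · right
      rw [← h0]
      norm_num
    · rcases hx with hx | hx
      · exact Or.inl (smul_ne_zero h0.ne' hx)
      · right
        have := t.2.2
        have := mul_pos h0 hx
        linarith
  refine ⟨⟨⟨fun z => ⟨(z.2.1.1, ⟨((z.1 : ℝ) • z.2.1.2.1.1,
    (z.1 : ℝ) * z.2.1.2.1.2 + (1 - z.1) * ε), fun h => ?_⟩), key z.1 z.2⟩, by fun_prop⟩, ?_, ?_⟩⟩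
  · rw [Prod.mk_eq_zero] at h
    rcases key z.1 z.2 with h' | h'
    · exact h' h.1
    · rw [h.2, mul_zero] at h'
      exact lt_irrefl _ h'
  · intro x
    refine Subtype.ext (Prod.ext rfl (Subtype.ext (Prod.ext ?_ ?_)))
    · simp [offRaySection]
    · simp [offRaySection]
  · intro x
    refine Subtype.ext (Prod.ext rfl (Subtype.ext (Prod.ext ?_ ?_)))
    · simp
    · simp

theorem acyclic_offRay (hY : Acyclic Y n) {ε : ℝ} (hε : ε * ε = 1) : Acyclic (offRay Y V ε) n :=
  hY.of_homotopic _ _ (offRay_homotopic hε)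

theorem isPathConnected_offRay [PathConnectedSpace Y] {ε : ℝ} (hε : ε * ε = 1) :
    IsPathConnected (offRay Y V ε) :=
  isPathConnected_iff_pathConnectedSpace.2
    (pathConnectedSpace_of_homotopic _ _ (offRay_homotopic hε))

variable [T1Space V]

/-- The parameter space `Y` makes the induction over the dimension of `V` apply to a sphere as well
as to the product of two spheres. The two open sets are the complements of two opposite rays: they
are homotopy equivalent to `Y`, and their intersection is homotopy equivalent to
`Y × Punctured V`. -/
theorem acyclic_punctured_zero (hY : Acyclic Y 0) [PathConnectedSpace Y]
    [PathConnectedSpace (Punctured V)] : Acyclic (Y × Punctured (V × ℝ)) 0 :=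
  Acyclic.of_cover_zero (isOpen_offRay 1) (isOpen_offRay (-1)) offRay_union
    (acyclic_offRay hY (by norm_num)) (acyclic_offRay hY (by norm_num))
    (isPathConnected_iff_pathConnectedSpace.2
      (pathConnectedSpace_of_homotopic _ _ (offRays_homotopic (Y := Y) (V := V))))

theorem acyclic_punctured_succ (hY : Acyclic Y (n + 1)) (h : Acyclic (Y × Punctured V) n) :
    Acyclic (Y × Punctured (V × ℝ)) (n + 1) :=
  Acyclic.of_cover_succ (isOpen_offRay 1) (isOpen_offRay (-1)) offRay_union
    (acyclic_offRay hY (by norm_num)) (acyclic_offRay hY (by norm_num))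
    (h.of_homotopic _ _ offRays_homotopic)

theorem acyclic_punctured_of_succ (hY : Acyclic Y n)
    (h : Acyclic (Y × Punctured (V × ℝ)) (n + 1)) : Acyclic (Y × Punctured V) n :=
  (Acyclic.inter_of_cover h (isOpen_offRay 1) (isOpen_offRay (-1)) offRay_union
    (acyclic_offRay hY (by norm_num)) (acyclic_offRay hY (by norm_num))).of_homotopic
      offRaysSection offRaysProj (by rw [offRaysProj_comp_section])

theorem isPathConnected_offRays_of_acyclic [PathConnectedSpace Y] [Nontrivial V]
    (h : Acyclic (Y × Punctured (V × ℝ)) 0) :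
    IsPathConnected (offRay Y V 1 ∩ offRay Y V (-1)) := by
  refine Acyclic.isPathConnected_inter h (isOpen_offRay 1) (isOpen_offRay (-1)) offRay_union
    (isPathConnected_offRay (by norm_num)) (isPathConnected_offRay (by norm_num)) ?_
  obtain ⟨v, hv⟩ := exists_ne (0 : V)
  exact ⟨(Classical.arbitrary Y, ⟨(v, 0), fun h => hv (Prod.mk_eq_zero.1 h).1⟩),
    mem_offRay_inter.2 hv⟩

end Punctured

instance pathConnectedSpace_punctured (V : Type) [AddCommGroup V] [Module ℝ V] [TopologicalSpace V]
    [IsTopologicalAddGroup V] [ContinuousSMul ℝ V] [Nontrivial V] :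
    PathConnectedSpace (Punctured (V × ℝ)) := by
  refine isPathConnected_iff_pathConnectedSpace.1
    (isPathConnected_compl_singleton_of_one_lt_rank ?_ (0 : V × ℝ))
  rw [rank_prod', Module.rank_self]
  have h : 1 ≤ Module.rank ℝ V := Cardinal.one_le_iff_pos.2 rank_pos
  calc (1 : Cardinal) < 1 + 1 := by rw [one_add_one_eq_two]; exact Cardinal.one_lt_two
    _ ≤ Module.rank ℝ V + 1 := by gcongr

/-- If the punctured plane had no cohomology in degree one, then the complement of a line in the
plane would be connected. -/
theorem not_acyclic_punctured_plane : ¬ Acyclic (PUnit × Punctured (ℝ × ℝ)) 0 := by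
  intro h
  have hc := isPathConnected_offRays_of_acyclic h
  obtain ⟨γ, hγ⟩ := hc.joinedIn (PUnit.unit, ⟨(-1, 0), by simp⟩) (mem_offRay_inter.2 (by norm_num))
    (PUnit.unit, ⟨(1, 0), by simp⟩) (mem_offRay_inter.2 (by norm_num))
  have hcont : Continuous fun t => (γ t).2.1.1 := by fun_prop
  obtain ⟨t, ht⟩ := mem_range_of_exists_le_of_exists_ge hcont (c := 0) ⟨0, by simp⟩ ⟨1, by simp⟩
  exact mem_offRay_inter.1 (hγ t) ht

/-- The four-dimensional vector space, built up one coordinate at a time. -/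
abbrev R4 : Type := ((ℝ × ℝ) × ℝ) × ℝ

theorem acyclic_prod_punctured_R4_zero {Y : Type} [TopologicalSpace Y] [PathConnectedSpace Y]
    (hY : Acyclic Y 0) : Acyclic (Y × Punctured R4) 0 :=
  acyclic_punctured_zero hY

theorem acyclic_prod_punctured_R4_one {Y : Type} [TopologicalSpace Y] [PathConnectedSpace Y]
    (hY : Acyclic Y 0) (hY' : Acyclic Y 1) : Acyclic (Y × Punctured R4) 1 :=
  acyclic_punctured_succ hY' (acyclic_punctured_zero hY)

theorem not_acyclic_punctured_R4 : ¬ Acyclic (PUnit × Punctured R4) 2 := fun h =>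
  not_acyclic_punctured_plane (acyclic_punctured_of_succ (acyclic_punit 0)
    (acyclic_punctured_of_succ (acyclic_punit 1) h))

/-- The Euclidean norm on `ℂ²`; the norm of `ℂ × ℂ` itself is the maximum norm. -/
def nrm (a : ℂ × ℂ) : ℝ := ‖WithLp.toLp 2 a‖

theorem nrm_sq (a : ℂ × ℂ) : nrm a ^ 2 = ‖a.1‖ ^ 2 + ‖a.2‖ ^ 2 := by
  exact WithLp.prod_norm_sq_eq_of_L2 _

theorem nrm_nonneg (a : ℂ × ℂ) : 0 ≤ nrm a := norm_nonneg _

theorem nrm_smul (r : ℝ) (a : ℂ × ℂ) : nrm (r • a) = |r| * nrm a := by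
  rw [nrm, WithLp.toLp_smul, norm_smul, Real.norm_eq_abs, nrm]

theorem nrm_eq_zero {a : ℂ × ℂ} : nrm a = 0 ↔ a = 0 := by
  rw [nrm, norm_eq_zero, WithLp.toLp_eq_zero]

theorem continuous_nrm : Continuous nrm := by
  unfold nrm
  fun_prop

theorem nrm_sphere (z : Sphere3) : nrm z.1 = 1 := by
  have := nrm_sq z.1
  rw [z.2] at this
  exact (pow_eq_one_iff_of_nonneg (nrm_nonneg _) two_ne_zero).1 this

theorem sphere_ne_zero (z : Sphere3) : z.1 ≠ 0 := fun h => by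
  have := nrm_sphere z
  rw [nrm_eq_zero.2 h] at this
  exact zero_ne_one this

/-- Radial projection to the sphere. -/
def normalize (a : Punctured (ℂ × ℂ)) : Sphere3 :=
  ⟨(nrm a.1)⁻¹ • a.1, by
    have h : nrm a.1 ≠ 0 := fun h => a.2 (nrm_eq_zero.1 h)
    rw [← nrm_sq, nrm_smul, abs_of_nonneg (inv_nonneg.2 (nrm_nonneg _)), inv_mul_cancel₀ h,
      one_pow]⟩

theorem continuous_normalize : Continuous normalize :=
  Continuous.subtype_mk (((continuous_nrm.comp continuous_subtype_val).inv₀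
    fun (a : Punctured (ℂ × ℂ)) h => a.2 (nrm_eq_zero.1 h)).smul continuous_subtype_val) _

theorem normalize_sphere (z : Sphere3) : normalize ⟨z.1, sphere_ne_zero z⟩ = z := by
  apply Subtype.ext
  change (nrm z.1)⁻¹ • z.1 = z.1
  rw [nrm_sphere, inv_one, one_smul]

/-- The coordinates on `ℂ²`. -/
def coords : (ℂ × ℂ) ≃L[ℝ] R4 :=
  LinearEquiv.toContinuousLinearEquiv
    { toFun := fun a => (((a.1.re, a.1.im), a.2.re), a.2.im)
      invFun := fun x => (⟨x.1.1.1, x.1.1.2⟩, ⟨x.1.2, x.2⟩)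
      map_add' := fun _ _ => rfl
      map_smul' := fun r a => by simp
      left_inv := fun _ => rfl
      right_inv := fun _ => rfl }

/-- The inclusion of the three-sphere in the punctured four-space. -/
def sphereIncl : C(Sphere3, Punctured R4) :=
  ⟨fun z => ⟨coords z.1, fun h => sphere_ne_zero z (coords.map_eq_zero_iff.1 h)⟩, by fun_prop⟩

/-- The retraction of the punctured four-space to the three-sphere. -/
def sphereRetr : C(Punctured R4, Sphere3) :=
  ⟨fun x => normalize ⟨coords.symm x.1, fun h => x.2 (coords.symm.map_eq_zero_iff.1 h)⟩,
    continuous_normalize.comp (by fun_prop)⟩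

theorem sphereRetr_comp_incl : sphereRetr.comp sphereIncl = ContinuousMap.id _ := by
  ext1 z
  have : sphereRetr (sphereIncl z) = normalize ⟨z.1, sphere_ne_zero z⟩ := by
    simp [sphereRetr, sphereIncl]
  exact this.trans (normalize_sphere z)

theorem sphereIncl_comp_retr :
    (sphereIncl.comp sphereRetr).Homotopic (ContinuousMap.id (Punctured R4)) := by
  have hpos : ∀ (t : I) (x : Punctured R4),
      0 < (1 - t : ℝ) * (nrm (coords.symm x.1))⁻¹ + t := by
    intro t x
    have h : 0 < nrm (coords.symm x.1) := (nrm_nonneg _).lt_of_ne' fun h =>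
      x.2 (coords.symm.map_eq_zero_iff.1 (nrm_eq_zero.1 h))
    rcases eq_or_lt_of_le t.2.1 with h0 | h0
    · rw [← h0]
      simpa using h
    · have := t.2.2
      have := mul_nonneg (sub_nonneg.2 this) (inv_pos.2 h).le
      linarith
  have hcont : Continuous fun z : I × Punctured R4 =>
      (1 - z.1 : ℝ) * (nrm (coords.symm z.2.1))⁻¹ + z.1 := by
    refine Continuous.add (Continuous.mul (by fun_prop) (Continuous.inv₀ ?_ ?_)) (by fun_prop)
    · exact continuous_nrm.comp (by fun_prop)
    · exact fun z h => z.2.2 (coords.symm.map_eq_zero_iff.1 (nrm_eq_zero.1 h))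
  refine ⟨⟨⟨fun z => ⟨((1 - z.1 : ℝ) * (nrm (coords.symm z.2.1))⁻¹ + z.1) • z.2.1,
    smul_ne_zero (hpos _ _).ne' z.2.2⟩, ?_⟩, ?_, ?_⟩⟩
  · exact Continuous.subtype_mk (hcont.smul (by fun_prop)) _
  · intro x
    apply Subtype.ext
    simp [sphereIncl, sphereRetr, normalize]
  · intro x
    apply Subtype.ext
    simp

instance : PathConnectedSpace Sphere3 :=
  pathConnectedSpace_of_homotopic sphereIncl sphereRetr (by rw [sphereRetr_comp_incl])

theorem acyclic_prod_sphere {Y : Type} [TopologicalSpace Y] {n : ℕ}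
    (h : Acyclic (Y × Punctured R4) n) : Acyclic (Y × Sphere3) n :=
  h.of_homotopic ((ContinuousMap.id Y).prodMap sphereIncl)
    ((ContinuousMap.id Y).prodMap sphereRetr) (by
      have : ((ContinuousMap.id Y).prodMap sphereRetr).comp
          ((ContinuousMap.id Y).prodMap sphereIncl) = ContinuousMap.id _ := by
        refine ContinuousMap.ext fun x => Prod.ext rfl ?_
        exact DFunLike.congr_fun sphereRetr_comp_incl x.2
      rw [this])

theorem acyclic_sphere {n : ℕ} (h : Acyclic (PUnit × Punctured R4) n) : Acyclic Sphere3 n :=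
  (acyclic_prod_sphere h).of_homotopic ⟨fun z => (PUnit.unit, z), by fun_prop⟩
    ContinuousMap.snd (ContinuousMap.Homotopic.refl _)

theorem acyclic_sphere_zero : Acyclic Sphere3 0 :=
  acyclic_sphere (acyclic_prod_punctured_R4_zero (acyclic_punit 0))

theorem acyclic_sphere_one : Acyclic Sphere3 1 :=
  acyclic_sphere (acyclic_prod_punctured_R4_one (acyclic_punit 0) (acyclic_punit 1))

theorem acyclic_sphere_prod_zero : Acyclic (Sphere3 × Sphere3) 0 :=
  acyclic_prod_sphere (acyclic_prod_punctured_R4_zero acyclic_sphere_zero)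

theorem acyclic_sphere_prod_one : Acyclic (Sphere3 × Sphere3) 1 :=
  acyclic_prod_sphere (acyclic_prod_punctured_R4_one acyclic_sphere_zero acyclic_sphere_one)

theorem not_acyclic_sphere_two : ¬ Acyclic Sphere3 2 := fun h =>
  not_acyclic_punctured_R4 (h.of_homotopic
    (sphereRetr.comp (ContinuousMap.snd : C(PUnit × Punctured R4, Punctured R4)))
    ((ContinuousMap.const _ PUnit.unit).prodMk sphereIncl) (by
      obtain ⟨H⟩ := sphereIncl_comp_retr
      exact ⟨⟨⟨fun z => (PUnit.unit, H (z.1, z.2.2)), by fun_prop⟩,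
        fun x => Prod.ext rfl (H.apply_zero x.2), fun x => Prod.ext rfl (H.apply_one x.2)⟩⟩))

/-! ### Complements of graphs in `S³ × S³` -/

section Graph

/-- The complement of the graph of a self-map of the three-sphere. -/
def offGraph (φ : C(Sphere3, Sphere3)) : Set (Sphere3 × Sphere3) := {x | x.1 ≠ φ x.2}

theorem isOpen_offGraph (φ : C(Sphere3, Sphere3)) : IsOpen (offGraph φ) :=
  isOpen_ne_fun continuous_fst (by fun_prop)

theorem eq_of_smul_eq_smul {u w : Sphere3} {a b : ℝ} (ha : 0 ≤ a) (hb : 0 < b)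
    (h : a • u.1 = b • w.1) : u = w := by
  have h1 := congrArg nrm h
  rw [nrm_smul, nrm_smul, nrm_sphere, nrm_sphere, abs_of_nonneg ha, abs_of_pos hb, mul_one,
    mul_one] at h1
  rw [h1] at h
  exact Subtype.ext (smul_right_injective _ hb.ne' h)

/-- The antipodal map. -/
def antipode : C(Sphere3, Sphere3) :=
  ⟨fun z => ⟨-z.1, by simpa using z.2⟩, by fun_prop⟩

/-- The projection of the complement of a graph to the second factor. -/
def offGraphProj (φ : C(Sphere3, Sphere3)) : C(offGraph φ, Sphere3) := ⟨fun x => x.1.2, by fun_prop⟩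

theorem antipode_ne (z : Sphere3) : antipode z ≠ z := fun h => by
  have h1 : -z.1 = z.1 := congrArg Subtype.val h
  exact sphere_ne_zero z (self_eq_neg.1 h1.symm)

/-- The section of `offGraphProj` by antipodal points. -/
def offGraphSection (φ : C(Sphere3, Sphere3)) : C(Sphere3, offGraph φ) :=
  ⟨fun v => ⟨(antipode (φ v), v), antipode_ne (φ v)⟩, by fun_prop⟩

/-- In the complement of the graph of `φ`, a point `(u, v)` can be moved to `(-φ v, v)` by moving
`u` along the great circle through `φ v`. -/
theorem offGraph_homotopic (φ : C(Sphere3, Sphere3)) :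
    ((offGraphSection φ).comp (offGraphProj φ)).Homotopic (ContinuousMap.id _) := by
  have hne : ∀ (t : I) (x : offGraph φ), (t : ℝ) • x.1.1.1 - (1 - t : ℝ) • (φ x.1.2).1 ≠ 0 := by
    intro t x h
    rw [sub_eq_zero] at h
    rcases eq_or_lt_of_le t.2.2 with h1 | h1
    · rw [h1, sub_self, zero_smul, one_smul] at h
      exact sphere_ne_zero _ h
    · exact x.2 (eq_of_smul_eq_smul t.2.1 (sub_pos.2 h1) h)
  let m : I × offGraph φ → Sphere3 := fun z =>
    normalize ⟨(z.1 : ℝ) • z.2.1.1.1 - (1 - z.1 : ℝ) • (φ z.2.1.2).1, hne z.1 z.2⟩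
  have hm : ∀ z, m z ≠ φ z.2.1.2 := by
    intro z h
    have h1 : (nrm ((z.1 : ℝ) • z.2.1.1.1 - (1 - z.1 : ℝ) • (φ z.2.1.2).1))⁻¹ •
        ((z.1 : ℝ) • z.2.1.1.1 - (1 - z.1 : ℝ) • (φ z.2.1.2).1) = (φ z.2.1.2).1 :=
      congrArg Subtype.val h
    have hr := nrm_nonneg ((z.1 : ℝ) • z.2.1.1.1 - (1 - z.1 : ℝ) • (φ z.2.1.2).1)
    generalize nrm ((z.1 : ℝ) • z.2.1.1.1 - (1 - z.1 : ℝ) • (φ z.2.1.2).1) = r at h1 hr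
    have hr' := inv_nonneg.2 hr
    have ht := z.1.2.2
    refine z.2.2 (eq_of_smul_eq_smul (a := r⁻¹ * z.1) (b := 1 + r⁻¹ * (1 - z.1))
      (mul_nonneg hr' z.1.2.1) (by nlinarith [mul_nonneg hr' (sub_nonneg.2 ht)]) ?_)
    rw [smul_sub, smul_smul, smul_smul, sub_eq_iff_eq_add] at h1
    rw [h1, add_smul, one_smul]
  have hcont : Continuous m := continuous_normalize.comp (by fun_prop)
  refine ⟨⟨⟨fun z => ⟨(m z, z.2.1.2), hm z⟩, by fun_prop⟩, fun x => ?_, fun x => ?_⟩⟩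
  · refine Subtype.ext (Prod.ext ?_ rfl)
    have : m (0, x) = normalize ⟨(antipode (φ x.1.2)).1, sphere_ne_zero _⟩ := by
      simp [m, antipode]
    exact this.trans (normalize_sphere _)
  · refine Subtype.ext (Prod.ext ?_ rfl)
    have : m (1, x) = normalize ⟨x.1.1.1, sphere_ne_zero _⟩ := by
      simp [m]
    exact this.trans (normalize_sphere _)

/-- The complement of a graph is homotopy equivalent to `S³`. -/
theorem acyclic_offGraph (φ : C(Sphere3, Sphere3)) {n : ℕ} (h : Acyclic Sphere3 n) :
    Acyclic (offGraph φ) n :=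
  h.of_homotopic _ _ (offGraph_homotopic φ)

theorem isPathConnected_offGraph (φ : C(Sphere3, Sphere3)) : IsPathConnected (offGraph φ) :=
  isPathConnected_iff_pathConnectedSpace.2
    (pathConnectedSpace_of_homotopic _ _ (offGraph_homotopic φ))

/-- The rotation of both coordinates by points of the circle. -/
def spin (a b : Circle) (z : Sphere3) : Sphere3 :=
  ⟨((a : ℂ) * z.1.1, (b : ℂ) * z.1.2), by
    rw [norm_mul, norm_mul, Circle.norm_coe, Circle.norm_coe, one_mul, one_mul]
    exact z.2⟩

theorem continuous_spin {T : Type} [TopologicalSpace T] {a b : T → Circle} {z : T → Sphere3}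
    (ha : Continuous a) (hb : Continuous b) (hz : Continuous z) :
    Continuous fun t => spin (a t) (b t) (z t) := by
  unfold spin
  fun_prop

theorem spin_one (z : Sphere3) : spin 1 1 z = z := by
  simp [spin]

theorem spin_spin (a b c d : Circle) (z : Sphere3) :
    spin a b (spin c d z) = spin (a * c) (b * d) z := by
  simp [spin, mul_assoc]

theorem spin_injective (a b : Circle) : Function.Injective (spin a b) := by
  refine Function.LeftInverse.injective (g := spin a⁻¹ b⁻¹) fun z => ?_
  rw [spin_spin, inv_mul_cancel, inv_mul_cancel, spin_one]

/-- A path of rotations from the identity to `spin a b`. -/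
def spinPath (a b : Circle) (t : I) (z : Sphere3) : Sphere3 :=
  spin (Circle.exp (t * (a : ℂ).arg)) (Circle.exp (t * (b : ℂ).arg)) z

theorem spinPath_zero (a b : Circle) (z : Sphere3) : spinPath a b 0 z = z := by
  simp [spinPath, spin_one]

theorem spinPath_one (a b : Circle) (z : Sphere3) : spinPath a b 1 z = spin a b z := by
  simp [spinPath]

theorem continuous_spinPath (a b : Circle) {T : Type} [TopologicalSpace T] {t : T → I}
    {z : T → Sphere3} (ht : Continuous t) (hz : Continuous z) :
    Continuous fun x => spinPath a b (t x) (z x) :=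
  continuous_spin (by fun_prop) (by fun_prop) hz

theorem antipode_homotopic : antipode.Homotopic (ContinuousMap.id Sphere3) := by
  refine ContinuousMap.Homotopic.symm ⟨⟨⟨fun x => spinPath (Circle.exp Real.pi)
    (Circle.exp Real.pi) x.1 x.2, continuous_spinPath _ _ (by fun_prop) (by fun_prop)⟩,
    fun z => spinPath_zero _ _ z, fun z => (spinPath_one _ _ z).trans ?_⟩⟩
  simp [spin, antipode]
  rfl

/-- There is a three-dimensional cocycle on `S³ × S³` that vanishes off the diagonal and is not a
coboundary: the difference of the pull-backs of a generator of `H³(S³)` under the two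
projections. -/
theorem exists_cocycle_vanishesOn_offGraph_id :
    ∃ d : Simp (Sphere3 × Sphere3) 3 → ℤ, delta d = 0 ∧
      VanishesOn (offGraph (ContinuousMap.id _)) d ∧ ¬ ∃ b, delta b = d := by
  obtain ⟨ω, hω, hne⟩ : ∃ ω : Simp Sphere3 3 → ℤ, delta ω = 0 ∧ ¬ ∃ b, delta b = ω := by
    have := not_acyclic_sphere_two
    unfold Acyclic at this
    push Not at this
    obtain ⟨ω, h1, h2⟩ := this
    exact ⟨ω, h1, fun ⟨b, hb⟩ => h2 b hb⟩
  let π₁ : C(Sphere3 × Sphere3, Sphere3) := ContinuousMap.fst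
  let π₂ : C(Sphere3 × Sphere3, Sphere3) := ContinuousMap.snd
  let c := comap π₁ ω - comap π₂ ω
  have hc : delta c = 0 := by
    rw [delta_sub, delta_comap, delta_comap, hω]
    exact sub_self _
  let U := offGraph (ContinuousMap.id Sphere3)
  obtain ⟨b₁, hb₁⟩ : ∃ b₁, delta b₁ =
      comap ((offGraphSection (ContinuousMap.id _)).comp (offGraphProj (ContinuousMap.id _)))
        (comap (incl U) c) - comap (incl U) c :=
    exists_delta_eq_of_homotopic (offGraph_homotopic (ContinuousMap.id Sphere3))
      (comap (incl U) c) (by rw [delta_comap, hc]; rfl)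
  obtain ⟨b₂, hb₂⟩ : ∃ b₂, delta b₂ = comap antipode ω - ω :=
    exists_delta_eq_of_homotopic antipode_homotopic ω hω
  have hsec : comap (offGraphSection (ContinuousMap.id _)) (comap (incl U) c)
      = comap antipode ω - ω := rfl
  have hexact : comap (incl U) c
      = delta (comap (offGraphProj (ContinuousMap.id Sphere3)) b₂ - b₁) := by
    rw [delta_sub, delta_comap, hb₁, hb₂, ← comap_comap, hsec, sub_sub_cancel]
  let e := comap (offGraphProj (ContinuousMap.id Sphere3)) b₂ - b₁
  refine ⟨c - delta (extendZero e), by rw [delta_sub, hc, delta_delta, sub_self],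
    comap_incl_eq_zero.1 ?_, ?_⟩
  · rw [comap_sub, ← delta_comap, comap_extendZero, hexact, sub_self]
  rintro ⟨b, hb⟩
  let v₀ : Sphere3 := Classical.arbitrary _
  let i : C(Sphere3, Sphere3 × Sphere3) := ⟨fun u => (u, v₀), by fun_prop⟩
  obtain ⟨k, hk⟩ := acyclic_punit 2 (comap (ContinuousMap.const PUnit v₀) ω)
    (by rw [delta_comap, hω]; rfl)
  refine hne ⟨comap i (b + extendZero e)
    + comap (ContinuousMap.const Sphere3 PUnit.unit) k, ?_⟩
  rw [delta_add, delta_comap, delta_comap, delta_add, hb, hk, sub_add_cancel]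
  funext s
  change ω s - ω _ + ω _ = ω s
  exact sub_add_cancel _ _

end Graph

/-! ### The orbit configuration space -/

section Orbit

variable (p q : ℕ) [NeZero p]

/-- The rotation `rot p q k` as a continuous map. -/
def rotMap (k : ZMod p) : C(Sphere3, Sphere3) := ⟨rot p q k, continuous_rot p q k⟩

/-- The pairs `(u, v)` with `u ≠ rot p q k v` for all `k ∈ J`. -/
def offOrbit (J : Finset (ZMod p)) : Set (Sphere3 × Sphere3) := {x | ∀ k ∈ J, x.1 ≠ rot p q k x.2}

/-- The rotation of the first factor of `S³ × S³`. -/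
def rotFst (k : ZMod p) : C(Sphere3 × Sphere3, Sphere3 × Sphere3) :=
  (rotMap p q k).prodMap (ContinuousMap.id _)

variable {p q}

theorem rot_eq_spin (k : ZMod p) (z : Sphere3) :
    rot p q k z = spin (ZMod.toCircle k) (ZMod.toCircle ((q : ZMod p) * k)) z := rfl

theorem rot_injective (k : ZMod p) : Function.Injective (rot p q k) := fun _ _ h =>
  spin_injective _ _ h

theorem rot_spin (k : ZMod p) (a b : Circle) (z : Sphere3) :
    rot p q k (spin a b z) = spin a b (rot p q k z) := by
  rw [rot_eq_spin, rot_eq_spin, spin_spin, spin_spin, mul_comm a, mul_comm b]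

/-- The rotation group acts freely on the sphere. -/
theorem eq_of_rot_eq_rot (hcop : Nat.Coprime p q) {j k : ZMod p} {z : Sphere3}
    (h : rot p q j z = rot p q k z) : j = k := by
  have h1 : (ZMod.toCircle j : ℂ) * z.1.1 = ZMod.toCircle k * z.1.1 :=
    congrArg (fun x : Sphere3 => x.1.1) h
  have h2 : (ZMod.toCircle ((q : ZMod p) * j) : ℂ) * z.1.2
      = ZMod.toCircle ((q : ZMod p) * k) * z.1.2 := congrArg (fun x : Sphere3 => x.1.2) h
  by_cases hz : z.1.1 = 0
  · have hw : z.1.2 ≠ 0 := fun hw => sphere_ne_zero z (Prod.ext hz hw)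
    have h3 := ZMod.injective_toCircle (Subtype.ext (mul_right_cancel₀ hw h2))
    exact ((ZMod.isUnit_iff_coprime q p).2 hcop.symm).mul_left_cancel h3
  · exact ZMod.injective_toCircle (Subtype.ext (mul_right_cancel₀ hz h1))

theorem rotFst_homotopic (k : ZMod p) : (rotFst p q k).Homotopic (ContinuousMap.id _) := by
  refine ContinuousMap.Homotopic.symm ⟨⟨⟨fun x => (spinPath (ZMod.toCircle k)
    (ZMod.toCircle ((q : ZMod p) * k)) x.1 x.2.1, x.2.2), ?_⟩, fun z => ?_, fun z => ?_⟩⟩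
  · exact (continuous_spinPath _ _ (by fun_prop) (by fun_prop)).prodMk (by fun_prop)
  · exact Prod.ext (spinPath_zero _ _ _) rfl
  · exact Prod.ext (spinPath_one _ _ _) rfl

theorem rotFst_comp (j k : ZMod p) :
    (rotFst p q j).comp (rotFst p q k) = rotFst p q (j + k) :=
  ContinuousMap.ext fun x => Prod.ext (rot_rot p q j k x.1) rfl

theorem rotFst_mem (j k : ZMod p) {x : Sphere3 × Sphere3} (hx : x ∈ offGraph (rotMap p q j)) :
    rotFst p q k x ∈ offGraph (rotMap p q (j + k)) := by
  intro h
  have h : rot p q k x.1 = rot p q (j + k) x.2 := h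
  rw [add_comm, ← rot_rot] at h
  exact hx (rot_injective k h)

theorem offOrbit_empty : offOrbit p q ∅ = Set.univ :=
  Set.eq_univ_of_forall fun _ k hk => absurd hk (Finset.notMem_empty k)

theorem offOrbit_insert (j : ZMod p) (J : Finset (ZMod p)) :
    offOrbit p q (insert j J) = offOrbit p q J ∩ offGraph (rotMap p q j) := by
  ext x
  refine ⟨fun h => ⟨fun k hk => h k (Finset.mem_insert_of_mem hk),
    h j (Finset.mem_insert_self _ _)⟩, fun h k hk => ?_⟩
  rcases Finset.mem_insert.1 hk with rfl | hk
  · exact h.2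
  · exact h.1 k hk

theorem offOrbit_subset {j : ZMod p} {J : Finset (ZMod p)} (h : j ∈ J) :
    offOrbit p q J ⊆ offGraph (rotMap p q j) := fun _ hx => hx j h

theorem isOpen_offOrbit (J : Finset (ZMod p)) : IsOpen (offOrbit p q J) := by
  induction J using Finset.induction_on with
  | empty => rw [offOrbit_empty]; exact isOpen_univ
  | insert j J _ ih => rw [offOrbit_insert]; exact ih.inter (isOpen_offGraph _)

theorem offOrbit_union (hcop : Nat.Coprime p q) {j : ZMod p} {J : Finset (ZMod p)} (hj : j ∉ J) :
    offOrbit p q J ∪ offGraph (rotMap p q j) = Set.univ := by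
  refine Set.eq_univ_of_forall fun x => ?_
  by_contra h
  rw [Set.mem_union, not_or] at h
  have h2 : x.1 = rot p q j x.2 := not_not.1 h.2
  refine h.1 fun k hk hk' => hj ?_
  rwa [eq_of_rot_eq_rot hcop (h2.symm.trans hk')]

theorem offOrbit_nonempty (J : Finset (ZMod p)) : (offOrbit p q J).Nonempty := by
  refine ⟨(⟨(1, 0), by simp⟩, ⟨(0, 1), by simp⟩), fun k _ h => ?_⟩
  have : (1 : ℂ) = ZMod.toCircle k * 0 := congrArg (fun x : Sphere3 => x.1.1) h
  simp at this

theorem isPathConnected_offOrbit (hcop : Nat.Coprime p q) (J : Finset (ZMod p)) :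
    IsPathConnected (offOrbit p q J) := by
  induction J using Finset.induction_on with
  | empty => rw [offOrbit_empty]; exact isPathConnected_univ
  | insert j J hj ih =>
    have hne := offOrbit_nonempty (q := q) (insert j J)
    rw [offOrbit_insert] at hne ⊢
    exact acyclic_sphere_prod_zero.isPathConnected_inter (isOpen_offOrbit J) (isOpen_offGraph _)
      (offOrbit_union hcop hj) ih (isPathConnected_offGraph _) hne

/-- A cocycle on `S³ × S³` that vanishes on the complement of finitely many disjoint graphs is a sum
of cocycles that vanish on the complement of one graph each. -/
theorem exists_eq_sum_of_vanishesOn_offOrbit (hcop : Nat.Coprime p q) {n : ℕ}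
    (J : Finset (ZMod p)) {z : Simp (Sphere3 × Sphere3) n → ℤ} (hz : delta z = 0)
    (hJ : VanishesOn (offOrbit p q J) z) :
    ∃ d : ZMod p → Simp (Sphere3 × Sphere3) n → ℤ, (∀ j, delta (d j) = 0) ∧
      (∀ j, VanishesOn (offGraph (rotMap p q j)) (d j)) ∧ z = ∑ j ∈ J, d j := by
  induction J using Finset.induction_on generalizing z with
  | empty =>
    rw [offOrbit_empty] at hJ
    exact ⟨0, fun _ => delta_zero, fun _ _ _ => rfl, by rw [vanishesOn_univ hJ]; rfl⟩
  | insert j J hj ih =>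
    rw [offOrbit_insert] at hJ
    obtain ⟨a, b, rfl, ha, hb, haJ, hbj⟩ := exists_add_of_vanishesOn_inter (isOpen_offOrbit J)
      (isOpen_offGraph _) (offOrbit_union hcop hj) hz hJ
    obtain ⟨d, hd, hdv, rfl⟩ := ih ha haJ
    classical
    refine ⟨Function.update d j b, fun k => ?_, fun k => ?_, ?_⟩
    · rcases eq_or_ne k j with rfl | h
      · rwa [Function.update_self]
      · rw [Function.update_of_ne h]; exact hd k
    · rcases eq_or_ne k j with rfl | h
      · rwa [Function.update_self]
      · rw [Function.update_of_ne h]; exact hdv k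
    · rw [Finset.sum_insert hj, Function.update_self, add_comm]
      congr 1
      exact Finset.sum_congr rfl fun k hk =>
        (Function.update_of_ne (ne_of_mem_of_not_mem hk hj) _ _).symm

variable (p q) in
/-- The universal cover of the deleted square as a subspace of `S³ × S³`. -/
abbrev orbitSet : Set (Sphere3 × Sphere3) := {x | ∀ k : ZMod p, x.1 ≠ rot p q k x.2}

theorem orbitSet_eq : orbitSet p q = offOrbit p q Finset.univ :=
  Set.ext fun _ => ⟨fun h k _ => h k, fun h k => h k (Finset.mem_univ k)⟩

theorem isOpen_orbitSet : IsOpen (orbitSet p q) := orbitSet_eq (p := p) (q := q) ▸ isOpen_offOrbit _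

theorem pathConnectedSpace_orbitConf (hcop : Nat.Coprime p q) :
    PathConnectedSpace (OrbitConf p q) := by
  have h := isPathConnected_offOrbit hcop Finset.univ
  rw [← orbitSet_eq] at h
  exact isPathConnected_iff_pathConnectedSpace.1 h

theorem orbitSet_subset (j : ZMod p) : orbitSet p q ⊆ offGraph (rotMap p q j) := fun _ hx => hx j

/-- The inclusion of the orbit configuration space in `S³ × S³`. -/
def orbitIncl : C(OrbitConf p q, Sphere3 × Sphere3) := incl (orbitSet p q)

theorem orbitIncl_comp_deck (k : ZMod p) :
    orbitIncl.comp (deck p q k 0) = (rotFst p q k).comp orbitIncl :=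
  ContinuousMap.ext fun _ => Prod.ext rfl (rot_zero p q _)

/-- The sum of the translates of a two-dimensional cocycle `c` is a coboundary. Extend `c` to a
cochain `c'` on `S³ × S³`; then `δ c'` is a sum of cocycles `d j`, each vanishing off one graph. The
rotations permute the graphs, and the terms of the sum of the translates of `δ c'` that belong to
one graph add up to a cocycle that is cohomologous to `δ c'`, hence exact. It is even the coboundary
of a cochain `b j` that vanishes off the graph, because the complement of the graph has no `H²`. So
the sum of the translates of `c'` minus the sum of the `b j` is a cocycle on `S³ × S³`, which has no
`H²` either. -/
theorem exists_delta_eq_sum_deck (hcop : Nat.Coprime p q) {c : Simp (OrbitConf p q) 2 → ℤ}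
    (hc : delta c = 0) : ∃ b, delta b = ∑ k : ZMod p, comap (deck p q k 0) c := by
  let c' : Simp (Sphere3 × Sphere3) 2 → ℤ := extendZero (A := orbitSet p q) c
  have hc' : comap orbitIncl c' = c := comap_extendZero (A := orbitSet p q) c
  have hv : VanishesOn (offOrbit p q Finset.univ) (delta c') := by
    rw [← orbitSet_eq, ← comap_incl_eq_zero, ← delta_comap]
    exact (congrArg delta hc').trans hc
  obtain ⟨d, hd, hdv, hsum⟩ := exists_eq_sum_of_vanishesOn_offOrbit hcop _ (delta_delta c') hv
  -- the part of the sum of the translates of `δ c'` that vanishes off the `j`-th graph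
  have hex : ∀ j, ∃ b : Simp (Sphere3 × Sphere3) 2 → ℤ, VanishesOn (offGraph (rotMap p q j)) b ∧
      delta b = ∑ k, comap (rotFst p q k) (d (j + k)) := by
    intro j
    choose g hg using fun k : ZMod p =>
      exists_delta_eq_of_homotopic (rotFst_homotopic (q := q) k) (d (j + k)) (hd _)
    have h1 : delta (∑ k, g k + c') = ∑ k, comap (rotFst p q k) (d (j + k)) := by
      rw [delta_add, delta_sum, hsum, ← Equiv.sum_comp (Equiv.addLeft j) d,
        ← Finset.sum_add_distrib]
      refine Finset.sum_congr rfl fun k _ => ?_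
      rw [hg]
      funext s
      change (d (j + k) _ - d (j + k) s) + d (j + k) s = d (j + k) _
      exact sub_add_cancel _ _
    obtain ⟨a, ha⟩ := (acyclic_offGraph (rotMap p q j) acyclic_sphere_one).exists_vanishesOn
      (c := ∑ k, g k + c') (by
        rw [h1]
        exact VanishesOn.sum fun k _ => (hdv (j + k)).comap _ fun x hx => rotFst_mem j k hx)
    exact ⟨_, ha, by rw [delta_sub, delta_delta, sub_zero, h1]⟩
  choose b hbv hb using hex
  obtain ⟨h, hh⟩ := acyclic_sphere_prod_one (∑ k, comap (rotFst p q k) c' - ∑ j, b j) (by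
    rw [delta_sub, delta_sum, delta_sum, sub_eq_zero]
    simp only [delta_comap, hsum, comap_sum, hb]
    rw [Finset.sum_comm (f := fun j k => comap (rotFst p q k) (d (j + k)))]
    exact Finset.sum_congr rfl fun k _ =>
      (Equiv.sum_comp (Equiv.addRight k) fun j => comap (rotFst p q k) (d j)).symm)
  refine ⟨comap orbitIncl h, ?_⟩
  have hb0 : ∀ j, comap orbitIncl (b j) = 0 := fun j =>
    comap_incl_eq_zero.2 ((hbv j).mono (orbitSet_subset j))
  rw [delta_comap, hh, comap_sub, comap_sum, comap_sum, Finset.sum_eq_zero fun j _ => hb0 j,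
    sub_zero]
  refine Finset.sum_congr rfl fun k _ => ?_
  rw [comap_comap, ← orbitIncl_comp_deck, ← comap_comap, hc']

/-- For `p > 2`, a nontrivial rotation of the first factor acts nontrivially on the second
cohomology of the orbit configuration space. Let `d j` be the translates of a nontrivial cocycle
`d 0` that vanishes off the diagonal. They are cohomologous to each other on `S³ × S³`, and a
cochain `g` with `δ g = d j - d 0` is a cocycle off the graphs. If its class were invariant under
the rotation by `k`, then `d (j - k) - d (-k) - d j + d 0` would be the coboundary of a cochain that
vanishes off the graphs, and so would be its summand `d 0` that belongs to the diagonal. -/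
theorem exists_deck_not_cohomologous (hcop : Nat.Coprime p q) (hp : 2 < p) {k : ZMod p}
    (hk : k ≠ 0) : ∃ c : Simp (OrbitConf p q) 2 → ℤ, delta c = 0 ∧
      ¬ ∃ b, delta b = comap (deck p q k 0) c - c := by
  obtain ⟨d₀, hd₀, hv₀, hne⟩ := exists_cocycle_vanishesOn_offGraph_id
  have hrot0 : rotMap p q 0 = ContinuousMap.id _ := ContinuousMap.ext (rot_zero p q)
  let d : ZMod p → Simp (Sphere3 × Sphere3) 3 → ℤ := fun j => comap (rotFst p q (-j)) d₀
  have hd : ∀ j, delta (d j) = 0 := fun j => by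
    change comap (rotFst p q (-j)) (delta d₀) = 0
    rw [hd₀]
    rfl
  have hdv : ∀ j, VanishesOn (offGraph (rotMap p q j)) (d j) := fun j =>
    hv₀.comap _ fun x hx => by
      have := rotFst_mem j (-j) hx
      rwa [add_neg_cancel, hrot0] at this
  have hd0 : d 0 = d₀ := by
    have : rotFst p q (-0) = ContinuousMap.id _ := ContinuousMap.ext fun x =>
      Prod.ext (by rw [neg_zero]; exact rot_zero p q x.1) rfl
    change comap (rotFst p q (-0)) d₀ = d₀
    rw [this]
    rfl
  have hdk : ∀ j, comap (rotFst p q k) (d j) = d (j - k) := fun j => by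
    change comap (rotFst p q k) (comap (rotFst p q (-j)) d₀) = comap (rotFst p q (-(j - k))) d₀
    rw [comap_comap, rotFst_comp, neg_sub, sub_eq_add_neg, add_comm]
  -- with `j ∉ {0, k}`, none of the indices `j`, `-k` and `j - k` is zero
  obtain ⟨j, hj0, hjk⟩ : ∃ j : ZMod p, j ≠ 0 ∧ j ≠ k := by
    have : ((Finset.univ.erase (0 : ZMod p)).erase k).Nonempty := by
      rw [← Finset.card_pos, Finset.card_erase_of_mem (by simpa using hk),
        Finset.card_erase_of_mem (Finset.mem_univ _), Finset.card_univ, ZMod.card]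
      omega
    obtain ⟨j, hj⟩ := this
    rw [Finset.mem_erase, Finset.mem_erase] at hj
    exact ⟨j, hj.2.1, hj.1⟩
  obtain ⟨g, hg⟩ := exists_delta_eq_of_homotopic (rotFst_homotopic (q := q) (-j)) d₀ hd₀
  have hg : delta g = d j - d 0 := by rw [hg, hd0]; rfl
  refine ⟨comap orbitIncl g, ?_, ?_⟩
  · rw [delta_comap, hg, comap_sub]
    have h0 : ∀ j, comap (orbitIncl (p := p) (q := q)) (d j) = 0 := fun j =>
      comap_incl_eq_zero.2 ((hdv j).mono (orbitSet_subset j))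
    rw [h0, h0, sub_self]
  rintro ⟨b, hb⟩
  let b' : Simp (Sphere3 × Sphere3) 1 → ℤ := extendZero (A := orbitSet p q) b
  have hb' : comap orbitIncl b' = b := comap_extendZero (A := orbitSet p q) b
  let β := comap (rotFst p q k) g - g - delta b'
  have hβ : VanishesOn (orbitSet p q) β := by
    rw [← comap_incl_eq_zero]
    change comap orbitIncl β = 0
    rw [comap_sub, comap_sub, ← delta_comap, hb', hb, comap_comap, comap_comap, orbitIncl_comp_deck,
      sub_self]
  have hJ : (0 : ZMod p) ∉ Finset.univ.erase (0 : ZMod p) := Finset.notMem_erase _ _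
  have hmem : ∀ i : ZMod p, i ≠ 0 → VanishesOn (offOrbit p q (Finset.univ.erase 0)) (d i) :=
    fun i hi => (hdv i).mono (offOrbit_subset (Finset.mem_erase.2 ⟨hi, Finset.mem_univ _⟩))
  obtain ⟨a, -, ha⟩ := exists_delta_eq_of_delta_eq_add (b := β) (d := d (j - k) - d (0 - k) - d j)
    (e := d 0) (isOpen_offOrbit (Finset.univ.erase (0 : ZMod p)))
    (isOpen_offGraph (rotMap p q 0)) (offOrbit_union hcop hJ)
    (by
      rw [← offOrbit_insert, Finset.insert_erase (Finset.mem_univ _), ← orbitSet_eq]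
      exact hβ)
    (by
      rw [delta_sub, delta_sub, delta_delta, delta_comap, hg, comap_sub, hdk, hdk]
      abel)
    (hd 0)
    (((hmem _ (sub_ne_zero.2 hjk)).sub (hmem _ (by simpa using hk))).sub (hmem _ hj0)) (hdv 0)
  exact hne ⟨a, by rw [ha, hd0]⟩

end Orbit

/-! ### Functoriality and homotopy invariance of cohomology -/

section Functoriality

variable {X Y Z : Type} [TopologicalSpace X] [TopologicalSpace Y] [TopologicalSpace Z] {n : ℕ}

/-- The cohomology class of a cocycle. -/
def mkClass (φ : Cochain X n) (h : coboundary X n (n + 1) φ = 0) : SingularCohomology X n :=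
  QuotientAddGroup.mk ⟨φ, h⟩

theorem exists_mkClass (x : SingularCohomology X n) : ∃ φ h, mkClass (n := n) φ h = x := by
  obtain ⟨⟨φ, h⟩, rfl⟩ := QuotientAddGroup.mk_surjective x
  exact ⟨φ, h, rfl⟩

theorem pullback_mkClass (f : C(X, Y)) (φ : Cochain Y n) (h) :
    pullback f n (mkClass φ h)
      = mkClass (cochainPullback f n φ) (by rw [← cochainPullback_coboundary, h, map_zero]) := rfl

theorem delta_evalSimp {φ : Cochain X n} (h : coboundary X n (n + 1) φ = 0) :
    delta (evalSimp φ) = 0 := by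
  rw [← evalSimp_coboundary, h, evalSimp_zero]

theorem evalSimp_pullback (f : C(X, Y)) (φ : Cochain Y n) :
    evalSimp (cochainPullback f n φ) = comap f (evalSimp φ) := evalSimp_cochainPullback f φ

theorem evalSimp_sum {ι : Type*} (J : Finset ι) (φ : ι → Cochain X n) :
    evalSimp (∑ j ∈ J, φ j) = ∑ j ∈ J, evalSimp (φ j) :=
  map_sum (⟨⟨evalSimp, evalSimp_zero⟩, evalSimp_add⟩ : Cochain X n →+ (Simp X n → ℤ)) φ J

theorem mkClass_eq_zero_iff {φ : Cochain X (n + 1)} {h} :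
    mkClass φ h = 0 ↔ ∃ b, delta b = evalSimp φ := by
  refine (QuotientAddGroup.eq_zero_iff _).trans ⟨?_, ?_⟩
  · rintro ⟨ψ, hψ⟩
    exact ⟨evalSimp ψ, (evalSimp_coboundary ψ).symm.trans (congrArg evalSimp hψ)⟩
  · rintro ⟨b, hb⟩
    obtain ⟨ψ, rfl⟩ := evalSimp_surjective b
    exact ⟨ψ, evalSimp_injective ((evalSimp_coboundary ψ).trans hb)⟩

theorem mkClass_sub {φ ψ : Cochain X n} (h h') :
    mkClass φ h - mkClass ψ h' = mkClass (φ - ψ) (by rw [map_sub, h, h', sub_self]) := rfl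

theorem mkClass_eq_iff {φ ψ : Cochain X (n + 1)} {h h'} :
    mkClass φ h = mkClass ψ h' ↔ ∃ b, delta b = evalSimp φ - evalSimp ψ := by
  rw [← sub_eq_zero, mkClass_sub, mkClass_eq_zero_iff, evalSimp_sub]

theorem mkClass_sum {ι : Type*} (J : Finset ι) (φ : ι → Cochain X n) (h : ∀ j, _) :
    ∑ j ∈ J, mkClass (φ j) (h j)
      = mkClass (∑ j ∈ J, φ j) (by rw [map_sum, Finset.sum_eq_zero fun j _ => h j]) := by
  have h1 : ∑ j ∈ J, (⟨φ j, h j⟩ : cocycles X n)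
      = ⟨∑ j ∈ J, φ j, (by
        change coboundary X n (n + 1) _ = 0
        rw [map_sum, Finset.sum_eq_zero fun j _ => h j])⟩ :=
    Subtype.ext (AddSubgroup.val_finsetSum _ _ _)
  let π : cocycles X n →+ SingularCohomology X n := QuotientAddGroup.mk' _
  exact (map_sum π (fun j => ⟨φ j, h j⟩) J).symm.trans (congrArg π h1)

theorem pullback_of_homotopic {f g : C(X, Y)} (h : f.Homotopic g) :
    pullback f (n + 1) = pullback g (n + 1) := by
  refine AddMonoidHom.ext fun x => ?_
  obtain ⟨φ, hφ, rfl⟩ := exists_mkClass x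
  rw [pullback_mkClass, pullback_mkClass, mkClass_eq_iff, evalSimp_pullback, evalSimp_pullback]
  exact exists_delta_eq_of_homotopic h _ (delta_evalSimp hφ)

theorem pullback_id (x : SingularCohomology X (n + 1)) :
    pullback (ContinuousMap.id X) (n + 1) x = x := by
  obtain ⟨φ, hφ, rfl⟩ := exists_mkClass x
  rw [pullback_mkClass, mkClass_eq_iff, evalSimp_pullback]
  exact ⟨0, delta_zero.trans (sub_self _).symm⟩

theorem pullback_comp (f : C(X, Y)) (g : C(Y, Z)) (x : SingularCohomology Z (n + 1)) :
    pullback (g.comp f) (n + 1) x = pullback f (n + 1) (pullback g (n + 1) x) := by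
  obtain ⟨φ, hφ, rfl⟩ := exists_mkClass x
  rw [pullback_mkClass, pullback_mkClass, pullback_mkClass, mkClass_eq_iff, evalSimp_pullback,
    evalSimp_pullback, evalSimp_pullback, comap_comap, sub_self]
  exact ⟨0, delta_zero⟩

end Functoriality

end SingularCohomology

open SingularCohomology

/-! ### The action of the deck transformations on cohomology -/

section Deck

variable {p q : ℕ} [NeZero p]

theorem deck_zero : deck p q 0 0 = ContinuousMap.id _ :=
  ContinuousMap.ext fun _ => Subtype.ext (Prod.ext (rot_zero p q _) (rot_zero p q _))

theorem deck_deck (k l m n : ZMod p) (x : OrbitConf p q) :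
    deck p q k l (deck p q m n x) = deck p q (k + m) (l + n) x :=
  Subtype.ext (Prod.ext (rot_rot p q _ _ _) (rot_rot p q _ _ _))

theorem deckH2_zero (x : H2 p q) : deckH2 p q 0 0 x = x := by
  rw [deckH2, deck_zero, pullback_id]

theorem deckH2_deckH2 (k l m n : ZMod p) (x : H2 p q) :
    deckH2 p q k l (deckH2 p q m n x) = deckH2 p q (k + m) (l + n) x := by
  rw [deckH2, deckH2, ← pullback_comp, deckH2]
  congr 2
  exact ContinuousMap.ext fun y => by
    rw [ContinuousMap.comp_apply, deck_deck, add_comm m, add_comm n]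

theorem deckH2_bijective (m n : ZMod p) : Function.Bijective (deckH2 p q m n) :=
  Function.bijective_iff_has_inverse.2 ⟨deckH2 p q (-m) (-n),
    fun x => by rw [deckH2_deckH2, neg_add_cancel, neg_add_cancel, deckH2_zero],
    fun x => by rw [deckH2_deckH2, add_neg_cancel, add_neg_cancel, deckH2_zero]⟩

/-- A simultaneous rotation of both points is isotopic to the identity through rotations of `S³`
that commute with the action of `ℤ/p`. -/
theorem deck_diagonal_homotopic (m : ZMod p) :
    (deck p q m m).Homotopic (ContinuousMap.id _) := by
  refine ContinuousMap.Homotopic.symm ⟨⟨⟨fun x =>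
    ⟨(spinPath (ZMod.toCircle m) (ZMod.toCircle ((q : ZMod p) * m)) x.1 x.2.1.1,
      spinPath (ZMod.toCircle m) (ZMod.toCircle ((q : ZMod p) * m)) x.1 x.2.1.2), ?_⟩, ?_⟩,
      fun z => ?_, fun z => ?_⟩⟩
  · intro k hk
    exact x.2.2 k (spin_injective _ _ (hk.trans (rot_spin k _ _ _)))
  · exact Continuous.subtype_mk ((continuous_spinPath _ _ (by fun_prop) (by fun_prop)).prodMk
      (continuous_spinPath _ _ (by fun_prop) (by fun_prop))) _
  · exact Subtype.ext (Prod.ext (spinPath_zero _ _ _) (spinPath_zero _ _ _))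
  · exact Subtype.ext (Prod.ext (spinPath_one _ _ _) (spinPath_one _ _ _))

theorem deckH2_diagonal (m : ZMod p) (x : H2 p q) : deckH2 p q m m x = x := by
  rw [deckH2, pullback_of_homotopic (deck_diagonal_homotopic m), pullback_id]

theorem sum_deckH2 (hcop : Nat.Coprime p q) (x : H2 p q) : ∑ k, deckH2 p q k 0 x = 0 := by
  obtain ⟨φ, hφ, rfl⟩ := exists_mkClass x
  simp only [deckH2, pullback_mkClass]
  rw [mkClass_sum, mkClass_eq_zero_iff, evalSimp_sum]
  simp only [evalSimp_pullback]
  exact exists_delta_eq_sum_deck hcop (delta_evalSimp hφ)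

theorem exists_deckH2_ne (hcop : Nat.Coprime p q) (hp : 2 < p) {k : ZMod p} (hk : k ≠ 0) :
    ∃ x : H2 p q, deckH2 p q k 0 x ≠ x := by
  obtain ⟨c, hc, hne⟩ := exists_deck_not_cohomologous hcop hp hk
  obtain ⟨φ, rfl⟩ := evalSimp_surjective c
  have hφ : coboundary (OrbitConf p q) 2 (2 + 1) φ = 0 :=
    evalSimp_injective (by rw [evalSimp_coboundary, hc, evalSimp_zero])
  refine ⟨mkClass φ hφ, fun h => hne ?_⟩
  rw [deckH2, pullback_mkClass, mkClass_eq_iff, evalSimp_pullback] at h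
  exact h

end Deck

/-! ### The covering projections -/

section Covering

variable {p q : ℕ} [NeZero p]

instance : LocallyPathConnectedSpace Sphere3 := by
  have : LocallyPathConnectedSpace (Punctured (ℂ × ℂ)) :=
    (isOpen_ne (x := (0 : ℂ × ℂ))).locallyPathConnectedSpace
  exact (Topology.IsQuotientMap.of_inverse
    (Continuous.subtype_mk continuous_subtype_val sphere_ne_zero)
    continuous_normalize normalize_sphere).locallyPathConnectedSpace

instance : LocallyCompactSpace Sphere3 :=
  (isClosed_eq (f := fun z : ℂ × ℂ => ‖z.1‖ ^ 2 + ‖z.2‖ ^ 2) (by fun_prop)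
    continuous_const).isClosedEmbedding_subtypeVal.locallyCompactSpace

instance : LocallyPathConnectedSpace (OrbitConf p q) :=
  (isOpen_orbitSet (p := p) (q := q)).locallyPathConnectedSpace

variable (p q) in
/-- The action of `ℤ/p` on the sphere by rotations. -/
abbrev rotAction : AddAction (ZMod p) Sphere3 where
  vadd := rot p q
  zero_vadd := rot_zero p q
  add_vadd j k z := (rot_rot p q j k z).symm

theorem isAddQuotientCoveringMap_lensMk (hcop : Nat.Coprime p q) :
    letI := rotAction p q
    IsAddQuotientCoveringMap (lensMk p q) (ZMod p) := by
  let _ := rotAction p q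
  have : ContinuousConstVAdd (ZMod p) Sphere3 := ⟨continuous_rot p q⟩
  have : IsCancelVAdd (ZMod p) Sphere3 := ⟨fun j k z h => eq_of_rot_eq_rot hcop h⟩
  exact isQuotientMap_quotient_mk'.isAddQuotientCoveringMap_of_properlyDiscontinuousVAdd
    (fun {z w} => Quotient.eq.trans (exists_congr fun k => eq_comm))

theorem isCoveringMap_lensMk (hcop : Nat.Coprime p q) : IsCoveringMap (lensMk p q) :=
  let _ := rotAction p q
  (isAddQuotientCoveringMap_lensMk hcop).isCoveringMap

theorem lensMk_rot (k : ZMod p) (z : Sphere3) : lensMk p q (rot p q k z) = lensMk p q z :=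
  Quotient.sound ⟨k, rfl⟩

theorem exists_rot_of_lensMk_eq {z w : Sphere3} (h : lensMk p q z = lensMk p q w) :
    ∃ k, z = rot p q k w := Quotient.exact h

variable (p q) in
/-- The action of `(ℤ/p)²` on the orbit configuration space by deck transformations. -/
abbrev deckAction : AddAction (ZMod p × ZMod p) (OrbitConf p q) where
  vadd a := deck p q a.1 a.2
  zero_vadd x := by
    change deck p q 0 0 x = x
    rw [deck_zero]
    rfl
  add_vadd a b x := (deck_deck a.1 a.2 b.1 b.2 x).symm

theorem eq_of_deck_eq_deck (hcop : Nat.Coprime p q) {k l m n : ZMod p} {x : OrbitConf p q}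
    (h : deck p q k l x = deck p q m n x) : k = m ∧ l = n :=
  ⟨eq_of_rot_eq_rot hcop (congrArg (fun y : OrbitConf p q => y.1.1) h),
    eq_of_rot_eq_rot hcop (congrArg (fun y : OrbitConf p q => y.1.2) h)⟩

theorem orbitConfProj_deck (m n : ZMod p) (x : OrbitConf p q) :
    orbitConfProj p q (deck p q m n x) = orbitConfProj p q x :=
  Subtype.ext (Prod.ext (lensMk_rot _ _) (lensMk_rot _ _))

theorem exists_deck_of_orbitConfProj_eq {x y : OrbitConf p q}
    (h : orbitConfProj p q x = orbitConfProj p q y) : ∃ m n, x = deck p q m n y := by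
  obtain ⟨m, hm⟩ := exists_rot_of_lensMk_eq (congrArg (fun z : DeletedSquare p q => z.1.1) h)
  obtain ⟨n, hn⟩ := exists_rot_of_lensMk_eq (congrArg (fun z : DeletedSquare p q => z.1.2) h)
  exact ⟨m, n, Subtype.ext (Prod.ext hm hn)⟩

theorem orbitConfProj_surjective : Function.Surjective (orbitConfProj p q) := by
  rintro ⟨⟨x, y⟩, h⟩
  induction x using Quotient.inductionOn with | h u
  induction y using Quotient.inductionOn with | h v
  exact ⟨⟨(u, v), fun k hk => h (Quotient.sound ⟨k, hk⟩)⟩, rfl⟩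

theorem isOpenMap_orbitConfProj (hcop : Nat.Coprime p q) : IsOpenMap (orbitConfProj p q) := by
  intro V hV
  have hopen := (isCoveringMap_lensMk hcop).isOpenMap
  have h1 := (hopen.prodMap hopen) _ (isOpen_orbitSet.isOpenMap_subtype_val V hV)
  convert h1.preimage
    (continuous_subtype_val (p := fun x : LensSpace p q × LensSpace p q => x.1 ≠ x.2)) using 1
  ext x
  constructor
  · rintro ⟨y, hy, rfl⟩
    exact ⟨y.1, ⟨y, hy, rfl⟩, rfl⟩
  · rintro ⟨_, ⟨y, hy, rfl⟩, h⟩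
    exact ⟨y, hy, Subtype.ext h⟩

theorem isCoveringMap_orbitConfProj (hcop : Nat.Coprime p q) :
    IsCoveringMap (orbitConfProj p q) := by
  let _ := deckAction p q
  have : ContinuousConstVAdd (ZMod p × ZMod p) (OrbitConf p q) :=
    ⟨fun a => (deck p q a.1 a.2).continuous⟩
  have : LocallyCompactSpace (OrbitConf p q) :=
    isOpen_orbitSet.isOpenEmbedding_subtypeVal.locallyCompactSpace
  have : IsCancelVAdd (ZMod p × ZMod p) (OrbitConf p q) := ⟨fun a b x h =>
    Prod.ext (eq_of_deck_eq_deck hcop h).1 (eq_of_deck_eq_deck hcop h).2⟩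
  have hquot := (isOpenMap_orbitConfProj hcop).isQuotientMap (orbitConfProj p q).continuous
    orbitConfProj_surjective
  refine (hquot.isAddQuotientCoveringMap_of_properlyDiscontinuousVAdd (G := ZMod p × ZMod p)
    fun {x y} => ⟨fun h => ?_, ?_⟩).isCoveringMap
  · obtain ⟨m, n, h⟩ := exists_deck_of_orbitConfProj_eq h
    exact ⟨(m, n), h.symm⟩
  · rintro ⟨a, rfl⟩
    exact orbitConfProj_deck _ _ _

end Covering

/-! ### Lifts to the universal covers -/

/-- Lifts of homotopic paths from the same starting point have the same end point. -/
theorem IsCoveringMap.apply_one_eq_of_homotopic {E X : Type*} [TopologicalSpace E]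
    [TopologicalSpace X] {π : E → X} (cov : IsCoveringMap π) {x y : X} {γ γ' : Path x y}
    (h : γ.Homotopic γ') {l l' : C(I, E)} (hl : ∀ t, π (l t) = γ t) (hl' : ∀ t, π (l' t) = γ' t)
    (h0 : l 0 = l' 0) : l 1 = l' 1 := by
  have e : γ.toContinuousMap 0 = π (l 0) := (hl 0).symm
  have e' : γ'.toContinuousMap 0 = π (l 0) := (h0 ▸ hl' 0).symm
  rw [(cov.eq_liftPath_iff' e).2 ⟨funext hl, rfl⟩,
    (cov.eq_liftPath_iff' e').2 ⟨funext hl', h0.symm⟩]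
  exact cov.liftPath_apply_one_eq_of_homotopicRel h (l 0) e e'

section Lifts

variable {p q q' : ℕ} [NeZero p]

/-- The class of a loop in a lens space can be read off from any lift of the loop. -/
theorem isLensClass_iff (hcop : Nat.Coprime p q) {x : LensSpace p q} {γ : Path x x}
    {l : C(I, Sphere3)} (hl : ∀ t, lensMk p q (l t) = γ t) (m : ZMod p) :
    IsLensClass p q (FundamentalGroup.fromPath (Path.Homotopic.Quotient.mk γ)) m ↔
      l 1 = rot p q m (l 0) := by
  refine ⟨?_, fun h => ⟨γ, l, rfl, hl, h⟩⟩
  rintro ⟨γ', l', hγ, hl', h⟩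
  obtain ⟨k, hk⟩ := exists_rot_of_lensMk_eq (p := p) (q := q) (z := l 0) (w := l' 0)
    (by rw [hl, hl', γ.source, γ'.source])
  have := (isCoveringMap_lensMk hcop).apply_one_eq_of_homotopic
    (Path.Homotopic.Quotient.exact hγ).symm (l := l) (l' := (rotMap p q k).comp l') hl
    (fun t => (lensMk_rot _ _).trans (hl' t)) hk
  rw [this, hk, rot_rot, add_comm, ← rot_rot, ← h]
  rfl

/-- The class of a loop in the deleted square can be read off from any lift of the loop. -/
theorem isDeletedSquareClass_iff (hcop : Nat.Coprime p q) {x : DeletedSquare p q} {γ : Path x x}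
    {Γ : C(I, OrbitConf p q)} (hΓ : ∀ t, orbitConfProj p q (Γ t) = γ t) (m n : ZMod p) :
    IsDeletedSquareClass p q (FundamentalGroup.fromPath (Path.Homotopic.Quotient.mk γ)) m n ↔
      Γ 1 = deck p q m n (Γ 0) := by
  have h1 := isLensClass_iff hcop (γ := γ.map (DeletedSquare.fst p q).continuous)
    (l := ⟨fun t => (Γ t).1.1, by fun_prop⟩) (fun t => congrArg (DeletedSquare.fst p q) (hΓ t)) m
  have h2 := isLensClass_iff hcop (γ := γ.map (DeletedSquare.snd p q).continuous)
    (l := ⟨fun t => (Γ t).1.2, by fun_prop⟩) (fun t => congrArg (DeletedSquare.snd p q) (hΓ t)) n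
  refine (and_congr h1 h2).trans ⟨fun h => Subtype.ext (Prod.ext h.1 h.2), fun h => ⟨?_, ?_⟩⟩
  · exact congrArg (fun y : OrbitConf p q => y.1.1) h
  · exact congrArg (fun y : OrbitConf p q => y.1.2) h

/-- The effect of a map on fundamental groups in terms of lifted paths. -/
theorem HasPi1Matrix.apply_one (hcop : Nat.Coprime p q) (hcop' : Nat.Coprime p q')
    {f : C(DeletedSquare p q', DeletedSquare p q)} {y : OrbitConf p q'} {α β : ZMod p}
    (hf : HasPi1Matrix f (orbitConfProj p q' y) !![α, 0; 0, β]) {c : C(I, OrbitConf p q')}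
    {m n : ZMod p} (h0 : c 0 = y) (h1 : c 1 = deck p q' m n y) {Γ : C(I, OrbitConf p q)}
    (hΓ : ∀ t, orbitConfProj p q (Γ t) = f (orbitConfProj p q' (c t))) :
    Γ 1 = deck p q (α * m) (β * n) (Γ 0) := by
  let γ : Path (orbitConfProj p q' y) (orbitConfProj p q' y) :=
    ⟨(orbitConfProj p q').comp c, congrArg (orbitConfProj p q') h0,
      (congrArg (orbitConfProj p q') h1).trans (orbitConfProj_deck _ _ _)⟩
  have h := hf _ m n ((isDeletedSquareClass_iff hcop' (γ := γ) (Γ := c) (fun _ => rfl) m n).2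
    (by rw [h1, h0]))
  have h2 := (isDeletedSquareClass_iff hcop (γ := γ.map f.continuous) hΓ _ _).1 h
  simpa using h2

/-- The lifting criterion: a map lifts to the universal covers if it takes loops that lift to loops
to loops that lift to loops. -/
theorem exists_isLiftOf (hcop : Nat.Coprime p q) (hcop' : Nat.Coprime p q')
    {f : C(DeletedSquare p q', DeletedSquare p q)} (y : OrbitConf p q')
    (h : ∀ (c : C(I, OrbitConf p q')) (Γ : C(I, OrbitConf p q)), c 0 = y → c 1 = y →
      (∀ t, orbitConfProj p q (Γ t) = f (orbitConfProj p q' (c t))) → Γ 1 = Γ 0) :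
    ∃ F, IsLiftOf F f := by
  have cov := isCoveringMap_orbitConfProj hcop
  have := pathConnectedSpace_orbitConf hcop'
  obtain ⟨e, he⟩ := orbitConfProj_surjective (f (orbitConfProj p q' y))
  obtain ⟨F, hF, -⟩ := cov.existsUnique_continuousMap_lifts_of_range_le
    (f := f.comp (orbitConfProj p q')) he (by
      rintro _ ⟨g, rfl⟩
      obtain ⟨c, rfl⟩ := Quotient.mk_surjective g
      obtain ⟨Γ, hΓ, hΓ0⟩ := cov.exists_path_lifts
        ((f.comp (orbitConfProj p q')).comp c.toContinuousMap) e
        (by rw [he]; exact congrArg (f.comp (orbitConfProj p q')) c.source)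
      have hΓ1 := h c.toContinuousMap Γ c.source c.target fun t => congrFun hΓ t
      refine ⟨FundamentalGroup.fromPath (Path.Homotopic.Quotient.mk
        ⟨Γ, hΓ0, hΓ1.trans hΓ0⟩), ?_⟩
      rw [FundamentalGroup.mapOfEq_apply]
      refine congrArg Path.Homotopic.Quotient.mk (Path.ext ?_)
      exact hΓ)
  exact ⟨F, fun x => congrFun hF.2 x⟩

/-- Two lifts of a map differ by a deck transformation. -/
theorem IsLiftOf.exists_eq_deck_comp (hcop : Nat.Coprime p q) (hcop' : Nat.Coprime p q')
    {f : C(DeletedSquare p q', DeletedSquare p q)} {F G : C(OrbitConf p q', OrbitConf p q)}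
    (hF : IsLiftOf F f) (hG : IsLiftOf G f) : ∃ a b, F = (deck p q a b).comp G := by
  have := pathConnectedSpace_orbitConf hcop'
  let y : OrbitConf p q' := Classical.arbitrary _
  obtain ⟨a, b, h⟩ := exists_deck_of_orbitConfProj_eq ((hF y).trans (hG y).symm)
  refine ⟨a, b, DFunLike.coe_injective ((isCoveringMap_orbitConfProj hcop).eq_of_comp_eq
    F.continuous (ContinuousMap.continuous _) (funext fun x => ?_) y h)⟩
  exact (hF x).trans ((orbitConfProj_deck a b (G x)).trans (hG x)).symm

/-- A lift of `f` is equivariant with respect to the homomorphism induced by `f` on fundamental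
groups. -/
theorem IsLiftOf.comp_deck (hcop : Nat.Coprime p q) (hcop' : Nat.Coprime p q')
    {f : C(DeletedSquare p q', DeletedSquare p q)} {x₀ : DeletedSquare p q'} {α β : ZMod p}
    (hf : HasPi1Matrix f x₀ !![α, 0; 0, β]) {F : C(OrbitConf p q', OrbitConf p q)}
    (hF : IsLiftOf F f) (m n : ZMod p) :
    F.comp (deck p q' m n) = (deck p q (α * m) (β * n)).comp F := by
  have := pathConnectedSpace_orbitConf hcop'
  obtain ⟨y, rfl⟩ := orbitConfProj_surjective x₀
  obtain ⟨c⟩ := PathConnectedSpace.joined y (deck p q' m n y)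
  have h := hf.apply_one hcop hcop' (c := c.toContinuousMap) c.source c.target
    (Γ := F.comp c.toContinuousMap) fun t => hF (c t)
  have h : F (c 1) = deck p q (α * m) (β * n) (F (c 0)) := h
  rw [c.source, c.target] at h
  refine DFunLike.coe_injective ((isCoveringMap_orbitConfProj hcop).eq_of_comp_eq
    (ContinuousMap.continuous _) (ContinuousMap.continuous _) (funext fun x => ?_) y h)
  change orbitConfProj p q (F _) = orbitConfProj p q (deck p q _ _ (F x))
  rw [hF, orbitConfProj_deck, orbitConfProj_deck, hF]

/-- A self-map of the deleted square that is homotopic to the identity has a lift that is homotopic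
to the identity and commutes with the deck transformations. -/
theorem exists_isLiftOf_of_homotopic_id (hcop : Nat.Coprime p q)
    {h : C(DeletedSquare p q, DeletedSquare p q)} (hh : h.Homotopic (ContinuousMap.id _)) :
    ∃ K : C(OrbitConf p q, OrbitConf p q), IsLiftOf K h ∧ K.Homotopic (ContinuousMap.id _) ∧
      ∀ m n x, K (deck p q m n x) = deck p q m n (K x) := by
  have cov := isCoveringMap_orbitConfProj hcop
  obtain ⟨H⟩ := hh.symm
  let H' : C(I × OrbitConf p q, DeletedSquare p q) :=
    H.toContinuousMap.comp ((ContinuousMap.id I).prodMap (orbitConfProj p q))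
  have hH' : ∀ x, H' (0, x) = orbitConfProj p q (ContinuousMap.id _ x) := fun x =>
    H.apply_zero (orbitConfProj p q x)
  let L := cov.liftHomotopy H' (ContinuousMap.id _) hH'
  have hL0 : ∀ x, L (0, x) = x := cov.liftHomotopy_zero H' (ContinuousMap.id _) hH'
  have hL : ∀ x, orbitConfProj p q (L x) = H' x :=
    congrFun (cov.liftHomotopy_lifts H' (ContinuousMap.id _) hH')
  refine ⟨L.comp ((ContinuousMap.const _ 1).prodMk (ContinuousMap.id _)), fun x => ?_,
    ContinuousMap.Homotopic.symm ⟨⟨L, hL0, fun x => rfl⟩⟩, fun m n x => ?_⟩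
  · exact (hL (1, x)).trans (H.apply_one _)
  · -- both sides are end points of lifts of the same path with the same starting point
    have := cov.eq_of_comp_eq (g₁ := fun t : I => L (t, deck p q m n x))
      (g₂ := fun t : I => deck p q m n (L (t, x))) (by fun_prop) (by fun_prop)
      (funext fun t => ?_) 0 (by rw [hL0, hL0])
    · exact congrFun this 1
    · change orbitConfProj p q _ = orbitConfProj p q _
      rw [hL, orbitConfProj_deck, hL]
      exact congrArg (fun z => H (t, z)) (orbitConfProj_deck m n x)

end Lifts

/-! ### Lifts of homotopy equivalences -/

section Equivalence

variable {p q q' : ℕ} [NeZero p]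

theorem IsLiftOf.comp {q'' : ℕ} {f : C(DeletedSquare p q', DeletedSquare p q)}
    {g : C(DeletedSquare p q'', DeletedSquare p q')} {F : C(OrbitConf p q', OrbitConf p q)}
    {G : C(OrbitConf p q'', OrbitConf p q')} (hF : IsLiftOf F f) (hG : IsLiftOf G g) :
    IsLiftOf (F.comp G) (f.comp g) := fun x =>
  (hF (G x)).trans (congrArg f (hG x))

theorem IsLiftOf.bijective_pullback_of_homotopic_id (hcop : Nat.Coprime p q)
    {h : C(DeletedSquare p q, DeletedSquare p q)} (hh : h.Homotopic (ContinuousMap.id _))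
    {F : C(OrbitConf p q, OrbitConf p q)} (hF : IsLiftOf F h) :
    Function.Bijective (pullback F 2) := by
  obtain ⟨K, hK, hKid, -⟩ := exists_isLiftOf_of_homotopic_id hcop hh
  obtain ⟨a, b, rfl⟩ := hF.exists_eq_deck_comp hcop hcop hK
  convert deckH2_bijective (p := p) (q := q) a b using 1
  funext x
  rw [pullback_comp, pullback_of_homotopic hKid, pullback_id]
  rfl

/-- The effect of a homotopy right inverse `g` of `f` on fundamental groups in terms of lifted
paths: if a path `c` leads from a point to its image under `τ_{k,l}`, then a lift of its image under
`g` leads from a point to its image under `τ'_{m,n}`, where the matrix of `f` takes `(m, n)` to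
`(k, l)`. -/
theorem HasPi1Matrix.exists_deck_of_right_inverse (hcop : Nat.Coprime p q)
    (hcop' : Nat.Coprime p q') {f : C(DeletedSquare p q', DeletedSquare p q)}
    {g : C(DeletedSquare p q, DeletedSquare p q')} (hfg : (f.comp g).Homotopic (ContinuousMap.id _))
    {x₀ : DeletedSquare p q'} {α β : ZMod p} (hf : HasPi1Matrix f x₀ !![α, 0; 0, β])
    {F : C(OrbitConf p q', OrbitConf p q)} (hF : IsLiftOf F f) {y : OrbitConf p q}
    {c : C(I, OrbitConf p q)} {k l : ZMod p} (h0 : c 0 = y) (h1 : c 1 = deck p q k l y)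
    {Λ : C(I, OrbitConf p q')} (hΛ : ∀ t, orbitConfProj p q' (Λ t) = g (orbitConfProj p q (c t))) :
    ∃ m n, Λ 1 = deck p q' m n (Λ 0) ∧ α * m = k ∧ β * n = l := by
  have cov := isCoveringMap_orbitConfProj hcop
  obtain ⟨K, hK, -, hKd⟩ := exists_isLiftOf_of_homotopic_id hcop hfg
  obtain ⟨m, n, hmn⟩ := exists_deck_of_orbitConfProj_eq (x := Λ 1) (y := Λ 0)
    (by rw [hΛ, hΛ, h0, h1, orbitConfProj_deck])
  refine ⟨m, n, hmn, ?_⟩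
  -- `F ∘ Λ` and `K ∘ c` lift the same path, so they differ by a deck transformation
  have hFΛ : ∀ t, orbitConfProj p q (F (Λ t)) = orbitConfProj p q (K (c t)) := fun t => by
    rw [hF, hΛ, hK]
    rfl
  obtain ⟨a, b, hab⟩ := exists_deck_of_orbitConfProj_eq (hFΛ 0)
  have h := congrFun (cov.eq_of_comp_eq (g₁ := fun t => F (Λ t))
    (g₂ := fun t => deck p q a b (K (c t))) (by fun_prop) (by fun_prop)
    (funext fun t => (hFΛ t).trans (orbitConfProj_deck _ _ _).symm) 0 hab) 1
  have hd : F (deck p q' m n (Λ 0)) = deck p q (α * m) (β * n) (F (Λ 0)) :=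
    DFunLike.congr_fun (hF.comp_deck hcop hcop' hf m n) (Λ 0)
  have h : F (Λ 1) = deck p q a b (K (c 1)) := h
  rw [hmn, hd, h1, hKd, deck_deck, add_comm a, add_comm b, ← deck_deck, ← h0, ← hab] at h
  exact eq_of_deck_eq_deck hcop h

variable {f : ContinuousMap.HomotopyEquiv (DeletedSquare p q') (DeletedSquare p q)}
  {x₀ : DeletedSquare p q'} {α β : ZMod p}

theorem HasPi1Matrix.exists_isLiftOf (hcop : Nat.Coprime p q) (hcop' : Nat.Coprime p q')
    {f : C(DeletedSquare p q', DeletedSquare p q)} (hf : HasPi1Matrix f x₀ !![α, 0; 0, β]) :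
    ∃ F, IsLiftOf F f := by
  obtain ⟨y, rfl⟩ := orbitConfProj_surjective x₀
  refine _root_.exists_isLiftOf hcop hcop' y fun c Γ h0 h1 hΓ => ?_
  have := hf.apply_one hcop hcop' (m := 0) (n := 0) h0 (by rw [h1, deck_zero]; rfl) hΓ
  rw [this, mul_zero, mul_zero, deck_zero]
  rfl

/-- The diagonal entries of the matrix of a homotopy equivalence are units, since `(1, 1)` is in the
image of the matrix. -/
theorem HasPi1Matrix.isUnit (hcop : Nat.Coprime p q) (hcop' : Nat.Coprime p q')
    (hf : HasPi1Matrix f.toFun x₀ !![α, 0; 0, β]) : IsUnit α ∧ IsUnit β := by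
  obtain ⟨F, hF⟩ := hf.exists_isLiftOf hcop hcop'
  have := pathConnectedSpace_orbitConf hcop
  let y : OrbitConf p q := Classical.arbitrary _
  obtain ⟨c⟩ := PathConnectedSpace.joined y (deck p q 1 1 y)
  obtain ⟨e, he⟩ := orbitConfProj_surjective (f.invFun (orbitConfProj p q y))
  obtain ⟨Λ, hΛ, -⟩ := (isCoveringMap_orbitConfProj hcop').exists_path_lifts
    ((f.invFun.comp (orbitConfProj p q)).comp c.toContinuousMap) e
    (by rw [he]; exact (congrArg (f.invFun.comp (orbitConfProj p q)) c.source))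
  obtain ⟨m, n, -, hm, hn⟩ := hf.exists_deck_of_right_inverse hcop hcop' f.right_inv hF
    (c := c.toContinuousMap) c.source c.target (Λ := Λ) (congrFun hΛ)
  exact ⟨IsUnit.of_mul_eq_one m hm, IsUnit.of_mul_eq_one n hn⟩

/-- A lift of a homotopy equivalence induces an isomorphism on cohomology. A homotopy inverse has a
lift too, and the composites of the two lifts are homotopic to deck transformations. -/
theorem HasPi1Matrix.bijective_pullback (hcop : Nat.Coprime p q) (hcop' : Nat.Coprime p q')
    (hf : HasPi1Matrix f.toFun x₀ !![α, 0; 0, β]) {F : C(OrbitConf p q', OrbitConf p q)}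
    (hF : IsLiftOf F f.toFun) : Function.Bijective (pullback F 2) := by
  obtain ⟨hα, hβ⟩ := hf.isUnit hcop hcop'
  have := pathConnectedSpace_orbitConf hcop
  obtain ⟨G, hG⟩ : ∃ G, IsLiftOf G f.invFun := by
    refine _root_.exists_isLiftOf hcop' hcop (Classical.arbitrary _) fun c Λ h0 h1 hΛ => ?_
    obtain ⟨m, n, h, hm, hn⟩ := hf.exists_deck_of_right_inverse hcop hcop' f.right_inv hF
      (k := 0) (l := 0) h0 (by rw [h1, deck_zero]; rfl) hΛ
    rw [h, (hα.mul_right_eq_zero).1 hm, (hβ.mul_right_eq_zero).1 hn, deck_zero]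
    rfl
  have h1 := (hF.comp hG).bijective_pullback_of_homotopic_id hcop f.right_inv
  have h2 := (hG.comp hF).bijective_pullback_of_homotopic_id hcop' f.left_inv
  have e1 : ⇑(pullback (F.comp G) 2) = pullback G 2 ∘ pullback F 2 := funext (pullback_comp G F)
  have e2 : ⇑(pullback (G.comp F) 2) = pullback F 2 ∘ pullback G 2 := funext (pullback_comp F G)
  rw [e1] at h1
  rw [e2] at h2
  exact ⟨h1.1.of_comp, h2.2.of_comp⟩

theorem IsLiftOf.pullback_deckH2 (hcop : Nat.Coprime p q) (hcop' : Nat.Coprime p q')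
    {f : C(DeletedSquare p q', DeletedSquare p q)} (hf : HasPi1Matrix f x₀ !![α, 0; 0, β])
    {F : C(OrbitConf p q', OrbitConf p q)} (hF : IsLiftOf F f) (m n : ZMod p) (x : H2 p q) :
    pullback F 2 (deckH2 p q (α * m) (β * n) x) = deckH2 p q' m n (pullback F 2 x) := by
  rw [deckH2, deckH2, ← pullback_comp, ← pullback_comp, hF.comp_deck hcop hcop' hf]

/-- The matrix of a homotopy equivalence is not `diag(α, -α)` if `p > 2`: otherwise
`τ_{α,-α}^*`, and hence `τ_{2α,0}^*`, would be trivial like `τ'_{1,1}^*`. -/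
theorem HasPi1Matrix.le_two_of_neg (hcop : Nat.Coprime p q) (hcop' : Nat.Coprime p q')
    (hf : HasPi1Matrix f.toFun x₀ !![α, 0; 0, -α]) : p ≤ 2 := by
  by_contra! hp
  obtain ⟨F, hF⟩ := hf.exists_isLiftOf hcop hcop'
  have hα := (hf.isUnit hcop hcop').1
  have hne : α + α ≠ 0 := by
    rw [← two_mul, Ne, hα.mul_left_eq_zero]
    intro h2
    have : ((2 : ℕ) : ZMod p) = 0 := by exact_mod_cast h2
    exact absurd (Nat.le_of_dvd two_pos ((ZMod.natCast_eq_zero_iff 2 p).1 this)) (by omega)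
  obtain ⟨x, hx⟩ := exists_deckH2_ne hcop hp hne
  refine hx ((hf.bijective_pullback hcop hcop' hF).1 ?_)
  have h := hF.pullback_deckH2 hcop hcop' hf 1 1 x
  have h1 : deckH2 p q α (-α) x = deckH2 p q (α + α) 0 x :=
    (deckH2_diagonal α _).symm.trans (by rw [deckH2_deckH2, add_neg_cancel])
  rwa [deckH2_diagonal, mul_one, mul_one, h1] at h

end Equivalence

/-! ### The module structure on cohomology -/

section Module

variable {p : ℕ}

/-- The ring homomorphism from `ℤ[t]/(N)` that sends `t` to an endomorphism `T` with `N(T) = 0`. -/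
def cycRingHom {M : Type*} [AddCommGroup M] (T : AddMonoid.End M)
    (hT : ∑ i ∈ Finset.range p, T ^ i = 0) : CycRing p →+* AddMonoid.End M :=
  Ideal.Quotient.lift _ (Polynomial.aeval (R := ℤ) T).toRingHom fun P hP => by
    obtain ⟨Q, rfl⟩ := Ideal.mem_span_singleton.1 hP
    rw [AlgHom.toRingHom_eq_coe, RingHom.coe_coe, map_mul, map_sum]
    simp only [map_pow, Polynomial.aeval_X]
    rw [hT, zero_mul]

theorem cycRingHom_t {M : Type*} [AddCommGroup M] (T : AddMonoid.End M)
    (hT : ∑ i ∈ Finset.range p, T ^ i = 0) : cycRingHom T hT (CycRing.t p) = T :=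
  Polynomial.aeval_X T

/-- An endomorphism `T` with `N(T) = 0` makes an abelian group a `ℤ[t]/(N)`-module. -/
theorem exists_module_cycRing {M : Type*} [AddCommGroup M] (T : M →+ M)
    (hT : ∀ x, ∑ i ∈ Finset.range p, T^[i] x = 0) :
    ∃ _ : Module (CycRing p) M, ∀ (a : ℕ) (x : M), CycRing.t p ^ a • x = T^[a] x := by
  let T' : AddMonoid.End M := T
  have hT' : ∑ i ∈ Finset.range p, T' ^ i = 0 := by
    refine AddMonoidHom.ext fun x => (AddMonoidHom.finsetSum_apply _ _ _).trans ?_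
    refine (Finset.sum_congr rfl fun i _ => ?_).trans (hT x)
    exact congrFun (AddMonoid.End.coe_pow _ T' i) x
  refine ⟨Module.compHom _ (cycRingHom T' hT'), fun a x => ?_⟩
  change cycRingHom T' hT' (CycRing.t p ^ a) x = _
  rw [map_pow, cycRingHom_t]
  exact congrFun (AddMonoid.End.coe_pow _ T' a) x

variable {q : ℕ} [NeZero p]

theorem deckH2_iterate (a : ℕ) (x : H2 p q) : (deckH2 p q 1 0)^[a] x = deckH2 p q a 0 x := by
  induction a with
  | zero => rw [Nat.cast_zero, deckH2_zero]; rfl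
  | succ a ih =>
    rw [Function.iterate_succ_apply', ih, deckH2_deckH2, add_zero, Nat.cast_succ, add_comm]

theorem sum_deckH2_iterate (hcop : Nat.Coprime p q) (x : H2 p q) :
    ∑ i ∈ Finset.range p, (deckH2 p q 1 0)^[i] x = 0 := by
  rw [← sum_deckH2 hcop x]
  simp only [deckH2_iterate]
  refine Finset.sum_bij (fun i _ => (i : ZMod p)) (fun _ _ => Finset.mem_univ _) ?_
    (fun k _ => ⟨k.val, Finset.mem_range.2 k.val_lt, ZMod.natCast_zmod_val k⟩) fun _ _ => rfl
  intro i hi j hj h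
  rwa [ZMod.natCast_eq_natCast_iff', Nat.mod_eq_of_lt (Finset.mem_range.1 hi),
    Nat.mod_eq_of_lt (Finset.mem_range.1 hj)] at h

end Module

end

theorem propositionP (p q q' : ℕ) [NeZero p]
    (hq : 0 < q) (hqp : q < p) (hcop : Nat.Coprime p q)
    (hq' : 0 < q') (hqp' : q' < p) (hcop' : Nat.Coprime p q')
    (f : ContinuousMap.HomotopyEquiv (DeletedSquare p q') (DeletedSquare p q))
    (x₀ : DeletedSquare p q') (α : ZMod p) (s : ℤˣ)
    (hf : HasPi1Matrix f.toFun x₀ !![α, 0; 0, ((s : ℤ) : ZMod p) * α]) :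
    -- the sign is plus (for `p = 2` the two signs give the same matrix)
    (2 < p → s = 1) ∧
    HasPi1Matrix f.toFun x₀ !![α, 0; 0, α] ∧
    -- `f` lifts to the universal covers
    (∃ F : C(OrbitConf p q', OrbitConf p q), IsLiftOf F f.toFun) ∧
    -- every lift intertwines the deck actions, on the covers and on the second cohomology
    (∀ F : C(OrbitConf p q', OrbitConf p q), IsLiftOf F f.toFun →
      Function.Bijective (SingularCohomology.pullback F 2) ∧
      ∀ m n : ZMod p,
        F.comp (deck p q' m n) = (deck p q (α * m) (α * n)).comp F ∧
        ∀ x : H2 p q,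
          SingularCohomology.pullback F 2 (deckH2 p q (α * m) (α * n) x)
            = deckH2 p q' m n (SingularCohomology.pullback F 2 x)) ∧
    -- both cohomology groups are `ℤ[t]/(N)`-modules with `t` acting by the deck
    -- transformation `(1, 0)`, and `t ^ α` corresponds to `t` under every lift
    (∃ (_ : Module (CycRing p) (H2 p q)) (_ : Module (CycRing p) (H2 p q')),
      (∀ x : H2 p q, CycRing.t p • x = deckH2 p q 1 0 x) ∧
      (∀ x : H2 p q', CycRing.t p • x = deckH2 p q' 1 0 x) ∧
      ∀ F : C(OrbitConf p q', OrbitConf p q), IsLiftOf F f.toFun →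
        ∀ a : ℕ, (a : ZMod p) = α → ∀ x : H2 p q,
          SingularCohomology.pullback F 2 (CycRing.t p ^ a • x)
            = CycRing.t p • SingularCohomology.pullback F 2 x) := by
  have hp : 2 < p → s = 1 := by
    intro hp
    refine (Int.units_eq_one_or s).resolve_right ?_
    rintro rfl
    refine hp.not_ge (HasPi1Matrix.le_two_of_neg (α := α) hcop hcop' (f := f) (x₀ := x₀) ?_)
    simpa using hf
  have hf' : HasPi1Matrix f.toFun x₀ !![α, 0; 0, α] := by
    obtain rfl | rfl := Int.units_eq_one_or s
    · simpa using hf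
    · -- here `p = 2`, so `-1 = 1` in `ZMod p`
      obtain rfl : p = 2 := by
        have : ¬ 2 < p := fun h => by simpa using hp h
        omega
      have h1 : (((-1 : ℤˣ) : ℤ) : ZMod 2) = 1 := by decide
      rwa [h1, one_mul] at hf
  obtain ⟨M, hM⟩ := exists_module_cycRing (p := p) (deckH2 p q 1 0) (sum_deckH2_iterate hcop)
  obtain ⟨M', hM'⟩ := exists_module_cycRing (p := p) (deckH2 p q' 1 0) (sum_deckH2_iterate hcop')
  have ht' : ∀ x : H2 p q', CycRing.t p • x = deckH2 p q' 1 0 x := fun x => by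
    rw [← pow_one (CycRing.t p), hM', Function.iterate_one]
  refine ⟨hp, hf', hf'.exists_isLiftOf hcop hcop',
    fun F hF => ⟨hf'.bijective_pullback hcop hcop' hF, fun m n =>
      ⟨hF.comp_deck hcop hcop' hf' m n, hF.pullback_deckH2 hcop hcop' hf' m n⟩⟩,
    M, M', fun x => ?_, ht', ?_⟩
  · rw [← pow_one (CycRing.t p), hM, Function.iterate_one]
  rintro F hF a rfl x
  have h := hF.pullback_deckH2 hcop hcop' hf' 1 0 x
  rw [mul_one, mul_zero] at h
  rw [hM, deckH2_iterate, h, ht']
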